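/- Let $L\ge 1$, $m_1,m_2>0$, $\Omega>0$, $\overline\gamma_1,\overline\gamma_2>0$ and $\alpha_1,\alpha_2>1$, where $2\alpha_1\in\mathbb N$ and $\alpha_2=\alpha_1+\tfrac12$. For $i\in\{1,\dots,L\}$ and $j\in\{1,2\}$ let $N_{i,j}$ and $I_{i,j}$ be mutually independent real random variables such that $N_{i,j}^2$ has density $$\frac{m_j^{m_j}x^{m_j-1}}{\Omega^{m_j}\Gamma(m_j)}e^{-m_jx/\Omega}\quad(x>0)$$ (Nakagami-$m_j$ fading of mean square $\Omega$) and $I_{i,j}$ has the inverse-gamma density $$\frac{\overline\gamma_j^{\alpha_j}}{\Gamma(\alpha_j)y^{\alpha_j+1}}e^{-\overline\gamma_j/y}\quad(y>0).$$ Put $N_i=(N_{i,1}N_{i,2})^2$ and $I_i=I_{i,1}I_{i,2}$. Select an index $i^*$ with $I_{i^*}=\max_{1\le i\le L}I_i$ (a measurable random index), and let $$\gamma_{\rm out}=N_{i^*}\max_{1\le i\le L}I_i .$$ Write $\overline\gamma=\Omega^2\,\overline\gamma_1\overline\gamma_2$, $\tilde\gamma=m_1m_2/\overline\gamma$, $\mathcal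 S_1=\dfrac1{\Gamma(m_1)\Gamma(m_2)\Gamma(\alpha_1)\Gamma(\alpha_2)}$ and, for integers $i_1,i_2\ge0$ and $n=(n_0,\dots,n_{2\alpha_1-1})\in\mathbb N_0^{2\alpha_1}$ with $\sum_j n_j=i_2$, $$q=\alpha_1+\alpha_2+\sum_{j=1}^{2\alpha_1-1}j\,n_j,\qquad \mathcal A=(-1)^{i_1+i_2}\frac{i_2!}{n_0!\,n_1!\cdots n_{2\alpha_1-1}!}\prod_{j=1}^{2\alpha_1-1}\Big(\frac{2^j}{j!}\Big)^{n_j}.$$ Let $G^{m,n}_{p,q}$ be the Meijer G-function, $$G^{m,n}_{p,q}\Big(z\,\Big|{a_1,\dots,a_p\atop b_1,\dots,b_q}\Big)=\frac1{2\pi i}\int_{\mathcal L}\frac{\prod_{j=1}^m\Gamma(b_j-s)\prod_{k=1}^n\Gamma(1-a_k+s)}{\prod_{j=m+1}^q\Gamma(1-b_j+s)\prod_{k=n+1}^p\Gamma(a_k-s)}\,z^s\,ds,$$ where $\mathcal L$ is a vertical line, directed upwards, with the poles of the $\Gamma(b_j-s)$, $j\le m$, on its right and those of the $\Gamma(1-a_k+s)$,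 $k\le n$, on its left. Then $\gamma_{\rm out}$ is absolutely continuous and positive almost surely; a PDF of it vanishes on $(-\infty,0]$ and is given for $\gamma>0$ by $$f_{\gamma_{\rm out}}(\gamma)=\sum_{i_1=0}^{L-1}\sum_{i_2=0}^{i_1}\binom{L-1}{i_1}\binom{i_1}{i_2}\sum_{n_0+\cdots+n_{2\alpha_1-1}=i_2}\frac{\gamma^{-1}\mathcal A\,L\,\mathcal S_1}{(i_2+1)^{q-1/2}}\;G^{2,2}_{2,2}\bigg(\frac{\tilde\gamma\,\gamma}{(i_2+1)^2}\,\bigg|{\frac{3/2-q}2,\ \frac{5/2-q}2\atop m_1,\ m_2}\bigg).$$ Its CDF is $0$ for $\gamma\le0$ and, for $\gamma>0$, $$F_{\gamma_{\rm out}}(\gamma)=\sum_{i_1=0}^{L-1}\sum_{i_2=0}^{i_1}\binom{L-1}{i_1}\binom{i_1}{i_2}\sum_{n_0+\cdots+n_{2\alpha_1-1}=i_2}\frac{\mathcal A\,L\,\mathcal S_1}{(i_2+1)^{q-1/2}}\;G^{2,3}_{3,3}\bigg(\frac{\tilde\gamma\,\gamma}{(i_2+1)^2}\,\bigg|{1,\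 \frac{3/2-q}2,\ \frac{5/2-q}2\atop m_1,\ m_2,\ 0}\bigg).$$ -/

import Mathlib

open MeasureTheory ProbabilityTheory

noncomputable section

/-- The integrand of the Mellin–Barnes integral of the Meijer G-function
`G^{m,n}_{p,q}(z | a₁,…,a_p ; b₁,…,b_q)`:
`∏_{j ≤ m} Γ(b_j - s) ∏_{k ≤ n} Γ(1 - a_k + s) z^s /
  (∏_{j > m} Γ(1 - b_j + s) ∏_{k > n} Γ(a_k - s))`.
Indices start at `0` here; `Complex.Gamma` vanishes at the poles of the gamma function, so that
`(Complex.Gamma ·)⁻¹` is the entire function `1 / Γ`. -/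
def meijerIntegrand (m n : ℕ) {p q : ℕ} (a : Fin p → ℂ) (b : Fin q → ℂ) (z s : ℂ) : ℂ :=
  (∏ j : Fin q,
      if (j : ℕ) < m then Complex.Gamma (b j - s) else (Complex.Gamma (1 - b j + s))⁻¹) *
    (∏ k : Fin p,
      if (k : ℕ) < n then Complex.Gamma (1 - a k + s) else (Complex.Gamma (a k - s))⁻¹) *
    z ^ s

/-- The vertical line `Re s = c` separates the poles of the `Γ(b_j - s)`, `j ≤ m` (to its right)
from those of the `Γ(1 - a_k + s)`, `k ≤ n` (to its left). -/
def MeijerSeparates (m n : ℕ) {p q : ℕ} (a : Fin p → ℂ) (b : Fin q → ℂ) (c : ℝ) : Prop :=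
  (∀ j : Fin q, (j : ℕ) < m → c < (b j).re) ∧
    (∀ k : Fin p, (k : ℕ) < n → (a k).re - 1 < c)

open Classical in
/-- The Meijer G-function `G^{m,n}_{p,q}(z | a ; b) = (1 / 2πi) ∫ (meijerIntegrand) ds` along a
vertical line from `c - i∞` to `c + i∞` that separates the two families of poles (the value does
not depend on the line). If no separating vertical line exists the value is `0` by convention. -/
def meijerG (m n : ℕ) {p q : ℕ} (a : Fin p → ℂ) (b : Fin q → ℂ) (z : ℂ) : ℂ :=
  if h : ∃ c : ℝ, MeijerSeparates m n a b c then
    (1 / (2 * (Real.pi : ℂ))) *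
      ∫ t : ℝ, meijerIntegrand m n a b z ((h.choose : ℂ) + (t : ℂ) * Complex.I)
  else 0

/-- Density of the inverse-gamma distribution with shape `α` and scale `g`. -/
def invGammaPDFReal (α g y : ℝ) : ℝ :=
  if 0 < y then g ^ α / (Real.Gamma α * y ^ (α + 1)) * Real.exp (-(g / y)) else 0

/-- The inverse-gamma distribution with shape `α` and scale `g`. -/
def invGammaMeasure (α g : ℝ) : Measure ℝ :=
  volume.withDensity fun y => ENNReal.ofReal (invGammaPDFReal α g y)

/-- The double-shadowing channel for `L` UAVs and two scattering regions. `N i j` and `I i j` are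
the multipath and shadowing coefficients of UAV `i` in region `j`. The square of `N i j` is the
square of a Nakagami-`m j` variable of mean square `msq`, that is, gamma distributed with shape
`m j` and rate `m j / msq`; `I i j` is inverse-gamma with shape `α j` and scale `g j`; all the
coefficients are independent. -/
structure IsDoubleShadowingChannel {Ω : Type*} [MeasurableSpace Ω] (μ : Measure Ω) {L : ℕ}
    (m α g : Fin 2 → ℝ) (msq : ℝ) (N I : Fin L → Fin 2 → Ω → ℝ) : Prop where
  measurable_multipath : ∀ i j, Measurable (N i j)
  measurable_shadowing : ∀ i j, Measurable (I i j)
  law_multipath : ∀ i j, HasLaw (fun ω => N i j ω ^ 2) (gammaMeasure (m j) (m j / msq)) μ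
  law_shadowing : ∀ i j, HasLaw (I i j) (invGammaMeasure (α j) (g j)) μ
  indep : iIndepFun
    (fun k : (Fin L × Fin 2) ⊕ (Fin L × Fin 2) =>
      Sum.elim (fun p : Fin L × Fin 2 => N p.1 p.2) (fun p : Fin L × Fin 2 => I p.1 p.2) k) μ

/-- `N_i = (N_{i,1} N_{i,2})²`. -/
def multipathGain {Ω : Type*} {L : ℕ} (N : Fin L → Fin 2 → Ω → ℝ) (i : Fin L) (ω : Ω) : ℝ :=
  (N i 0 ω * N i 1 ω) ^ 2

/-- `I_i = I_{i,1} I_{i,2}`. -/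
def shadowingGain {Ω : Type*} {L : ℕ} (I : Fin L → Fin 2 → Ω → ℝ) (i : Fin L) (ω : Ω) : ℝ :=
  I i 0 ω * I i 1 ω

/-- `sel ω` is the index of the selected UAV: one whose shadowing variable is the largest. -/
def IsShadowingSelection {Ω : Type*} [MeasurableSpace Ω] {L : ℕ} (I : Fin L → Fin 2 → Ω → ℝ)
    (sel : Ω → Fin L) : Prop :=
  Measurable sel ∧ ∀ ω i, shadowingGain I i ω ≤ shadowingGain I (sel ω) ω

/-- The output SNR `γ_out = N_i · max_{1 ≤ i ≤ L} I_i`, where the factor `N_i` is that of the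
selected UAV. -/
def outputSNR {Ω : Type*} {L : ℕ} (N I : Fin L → Fin 2 → Ω → ℝ) (sel : Ω → Fin L) (ω : Ω) : ℝ :=
  multipathGain N (sel ω) ω * ⨆ i, shadowingGain I i ω

/-- `S₁ = 1 / (Γ(m₁) Γ(m₂) Γ(α₁) Γ(α₂))`. -/
def snrConst (m α : Fin 2 → ℝ) : ℝ :=
  1 / (Real.Gamma (m 0) * Real.Gamma (m 1) * Real.Gamma (α 0) * Real.Gamma (α 1))

/-- `γ̃ = m₁ m₂ / γ̄`, with `γ̄ = msq² g₁ g₂`. -/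
def snrScale (m g : Fin 2 → ℝ) (msq : ℝ) : ℝ :=
  m 0 * m 1 / (msq ^ 2 * (g 0 * g 1))

/-- `q = α₁ + α₂ + ∑_j j n_j`. -/
def snrExponent (α : Fin 2 → ℝ) {K : ℕ} (n : Fin K → ℕ) : ℝ :=
  α 0 + α 1 + ∑ j : Fin K, ((j : ℕ) : ℝ) * (n j : ℝ)

/-- `A = (-1)^{i₁+i₂} · i₂! / (n_0! ⋯ n_{K-1}!) · ∏_j (2^j / j!)^{n_j}`
(the factor `j = 0` of the last product is `1`). -/
def snrCoeff {K : ℕ} (i₁ i₂ : ℕ) (n : Fin K → ℕ) : ℝ :=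
  (i₂.factorial : ℝ) / (∏ j : Fin K, ((n j).factorial : ℝ)) *
    (∏ j : Fin K, ((2 : ℝ) ^ (j : ℕ) / ((j : ℕ).factorial : ℝ)) ^ n j) * (-1) ^ (i₁ + i₂)

/-- `A L S₁ / (i₂ + 1)^{q - 1/2}`. -/
def snrWeight (L : ℕ) (m α : Fin 2 → ℝ) {K : ℕ} (i₁ i₂ : ℕ) (n : Fin K → ℕ) : ℝ :=
  snrCoeff i₁ i₂ n * (L : ℝ) * snrConst m α / ((i₂ : ℝ) + 1) ^ (snrExponent α n - 1 / 2)

/-- The closed form of the output SNR's PDF: the sum over `0 ≤ i₁ ≤ L - 1`, `0 ≤ i₂ ≤ i₁` and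
`n_0 + ⋯ + n_{K-1} = i₂`, with `K = 2 α₁`. -/
def outputPDFFormula (L K : ℕ) (m α g : Fin 2 → ℝ) (msq x : ℝ) : ℂ :=
  ∑ i₁ ∈ Finset.range L, ∑ i₂ ∈ Finset.range (i₁ + 1),
    ((L - 1).choose i₁ : ℂ) * (i₁.choose i₂ : ℂ) *
      ∑ n ∈ Finset.piAntidiag (Finset.univ : Finset (Fin K)) i₂,
        (x : ℂ)⁻¹ * (snrWeight L m α i₁ i₂ n : ℂ) *
          meijerG 2 2
            ![(((3 / 2 - snrExponent α n) / 2 : ℝ) : ℂ), (((5 / 2 - snrExponent α n) / 2 : ℝ) : ℂ)]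
            ![(m 0 : ℂ), (m 1 : ℂ)]
            ((snrScale m g msq * x / ((i₂ : ℝ) + 1) ^ 2 : ℝ) : ℂ)

/-- The closed form of the output SNR's CDF. -/
def outputCDFFormula (L K : ℕ) (m α g : Fin 2 → ℝ) (msq x : ℝ) : ℂ :=
  ∑ i₁ ∈ Finset.range L, ∑ i₂ ∈ Finset.range (i₁ + 1),
    ((L - 1).choose i₁ : ℂ) * (i₁.choose i₂ : ℂ) *
      ∑ n ∈ Finset.piAntidiag (Finset.univ : Finset (Fin K)) i₂,
        (snrWeight L m α i₁ i₂ n : ℂ) *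
          meijerG 2 3
            ![1, (((3 / 2 - snrExponent α n) / 2 : ℝ) : ℂ),
              (((5 / 2 - snrExponent α n) / 2 : ℝ) : ℂ)]
            ![(m 0 : ℂ), (m 1 : ℂ), 0]
            ((snrScale m g msq * x / ((i₂ : ℝ) + 1) ^ 2 : ℝ) : ℂ)

end

/-! The half-integer gap between the two shapes makes the shadowing elementary. Since `g j / I i j`
is a unit-rate gamma variable of shape `α j`, the product of the two has Mellin transform
proportional to `Γ(α₁ - s) Γ(α₁ + 1/2 - s)`, in the sign convention of the G-function. Legendre's
duplication formula merges this into `Γ(2α₁ - 2s)`, so `U_i = 2 √(g₁ g₂ / I_i)` is gamma of shape `K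
= 2α₁` and rate `1` (`prodKernel_add_half`, `hasLaw_sqrt_of_invGamma`). As `K` is an integer, `U_i`
is Erlang and its tail is `e^{-u}` times a polynomial.

The largest `I_i` corresponds to the smallest `U_i`. The gains `N_i` are independent of the `U_i`,
so the selected gain keeps its law and is independent of `U = min U_i`, whose density is `L
T(u)^{L-1} u^{K-1} e^{-u} / Γ(K)` with `T` the Erlang tail (`measure_selected`, `gammaMeasure_Ioi`).
Hence `γ_out = 4 g₁ g₂ N / U²` almost surely, and `x f(x)` is an average over `u` of the Bessel-type
kernel of `N` at `γ̃ x u² / 4` (`map_outputSNR`).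

Two binomial expansions and one multinomial expansion of `T^{L-1}` reduce this average to
gamma-weighted ones, with exponent `q - 1/2` and rate `i₂ + 1`. On a vertical line each has Mellin
transform `Γ(m₁ - s) Γ(m₂ - s) Γ(k + 2s)` up to exponential factors, with `k = q - 1/2`.
Duplication, used now in the opposite direction, splits `Γ(k + 2s)` into the two remaining gamma
factors of `G^{2,2}_{2,2}`. Integrating against `dt / t` on `(0, x]` adds the factor `1 / s = Γ(s) /
Γ(1 + s)`, which gives `G^{2,3}_{3,3}`.

All Mellin identities rest on `MellinRep.average`: averaging dilations of a kernel multiplies its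
transform by the Mellin-type integral of the weight. -/

/-! ### Decay of the gamma function on vertical lines -/

/-- `Γ` is integrable along every vertical line in the right half-plane. -/
theorem integrable_Gamma_vertical {σ : ℝ} (hσ : 0 < σ) :
    Integrable fun t : ℝ => Complex.Gamma ((σ : ℂ) + (t : ℂ) * Complex.I) := by
  have hre : ∀ t : ℝ, ((σ : ℂ) + (t : ℂ) * Complex.I).re = σ := fun t => by simp
  have him : ∀ t : ℝ, ((σ : ℂ) + (t : ℂ) * Complex.I).im = t := fun t => by simp
  have hne : ∀ t : ℝ, ((σ : ℂ) + (t : ℂ) * Complex.I) ≠ 0 := fun t h => by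
    have := hre t; rw [h] at this; simp at this; exact hσ.ne this
  have hne1 : ∀ t : ℝ, ((σ : ℂ) + (t : ℂ) * Complex.I) + 1 ≠ 0 := fun t h => by
    have := congrArg Complex.re h; simp at this; linarith
  have hbound : ∀ s : ℂ, 0 < s.re → ‖Complex.Gamma s‖ ≤ Real.Gamma s.re := fun s hs => by
    rw [Complex.Gamma_eq_integral hs, Real.Gamma_eq_integral hs, Complex.GammaIntegral]
    refine (norm_integral_le_integral_norm _).trans_eq ?_
    refine setIntegral_congr_fun measurableSet_Ioi fun x (hx : 0 < x) => ?_
    simp [Complex.norm_cpow_eq_rpow_re_of_pos hx, -Complex.ofReal_exp, abs_of_pos (Real.exp_pos _)]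
  have hcont : Continuous fun t : ℝ => Complex.Gamma ((σ : ℂ) + (t : ℂ) * Complex.I) := by
    rw [continuous_iff_continuousAt]
    intro t
    refine ContinuousAt.comp (f := fun t : ℝ => (σ : ℂ) + (t : ℂ) * Complex.I)
      (Complex.differentiableAt_Gamma _ fun n h => ?_).continuousAt (by fun_prop)
    have := congrArg Complex.re h
    simp at this
    have : (0 : ℝ) ≤ n := n.cast_nonneg
    linarith
  -- From `Γ(s + 2) = (s + 1) s Γ(s)`, `|s| ≤ |s + 1|` and `|Γ(s + 2)| ≤ Γ(σ + 2)` the decay is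
  -- quadratic: `|Γ(s)| ≤ Γ(σ + 2) / (σ² + t²)`. The maximum is the cost of replacing `σ² + t²` by
  -- `1 + t²`.
  set C := Real.Gamma (σ + 2) * (max 1 (1 / (σ ^ 2)))
  refine (integrable_inv_one_add_sq.const_mul C).mono' hcont.aestronglyMeasurable
    (ae_of_all _ fun t => ?_)
  set s := (σ : ℂ) + (t : ℂ) * Complex.I
  have e1 : Complex.Gamma (s + 2) = (s + 1) * (s * Complex.Gamma s) := by
    rw [← Complex.Gamma_add_one s (hne t), ← Complex.Gamma_add_one _ (hne1 t)]
    congr 1; ring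
  have e2 : ‖Complex.Gamma (s + 2)‖ ≤ Real.Gamma (σ + 2) := by
    have := hbound (s + 2) (by simp [s]; linarith)
    simpa [s] using this
  have hG : 0 < Real.Gamma (σ + 2) := Real.Gamma_pos_of_pos (by linarith)
  have hs2 : ‖s‖ ^ 2 = σ ^ 2 + t ^ 2 := by
    rw [← Complex.normSq_eq_norm_sq, Complex.normSq_apply, hre, him]; ring
  have hs12 : ‖s‖ ≤ ‖s + 1‖ := by
    rw [Complex.norm_def, Complex.norm_def]
    apply Real.sqrt_le_sqrt
    simp only [Complex.normSq_apply, Complex.add_re, Complex.add_im, hre, him, s]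
    simp
    nlinarith
  have h3 : (σ ^ 2 + t ^ 2) * ‖Complex.Gamma s‖ ≤ Real.Gamma (σ + 2) := by
    calc _ = ‖s‖ * (‖s‖ * ‖Complex.Gamma s‖) := by rw [← hs2]; ring
      _ ≤ ‖s + 1‖ * (‖s‖ * ‖Complex.Gamma s‖) := by gcongr
      _ = ‖Complex.Gamma (s + 2)‖ := by rw [e1, norm_mul, norm_mul]
      _ ≤ _ := e2
  have hpos : 0 < σ ^ 2 + t ^ 2 := by positivity
  have h4 : ‖Complex.Gamma s‖ ≤ Real.Gamma (σ + 2) / (σ ^ 2 + t ^ 2) := by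
    rw [le_div_iff₀ hpos]; linarith
  refine h4.trans ?_
  rw [div_eq_mul_inv, mul_assoc]
  gcongr
  rw [← div_eq_mul_inv, inv_eq_one_div, div_le_div_iff₀ hpos (by positivity), one_mul]
  have m1 := le_max_left 1 (1 / σ ^ 2)
  have m2 := le_max_right 1 (1 / σ ^ 2)
  have m3 : 1 ≤ max 1 (1 / σ ^ 2) * σ ^ 2 := by
    rw [div_le_iff₀ (by positivity)] at m2; exact m2
  nlinarith [sq_nonneg t]

/-! ### Inverse Mellin representations -/

/-- `k` is on `(0, ∞)` the inverse Mellin transform of `G` along the line `Re s = c`, with the sign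
convention `z ^ s` of the Meijer G-function. -/
structure MellinRep (c : ℝ) (k : ℝ → ℝ) (G : ℂ → ℂ) : Prop where
  integrable : Integrable fun t : ℝ => G ((c : ℂ) + (t : ℂ) * Complex.I)
  eq : ∀ z : ℝ, 0 < z → (k z : ℂ) = (1 / (2 * (Real.pi : ℂ))) *
    ∫ t : ℝ, G ((c : ℂ) + (t : ℂ) * Complex.I) * (z : ℂ) ^ ((c : ℂ) + (t : ℂ) * Complex.I)

/-- The kernel `z ^ a e ^ {-z}`. -/
noncomputable def expKernel (a z : ℝ) : ℝ := z ^ a * Real.exp (-z)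

theorem measurable_expKernel (a : ℝ) : Measurable (expKernel a) := by
  unfold expKernel; fun_prop

theorem expKernel_nonneg (a : ℝ) {z : ℝ} (hz : 0 ≤ z) : 0 ≤ expKernel a z := by
  unfold expKernel; positivity

theorem mellinRep_expKernel {a c : ℝ} (hc : c < a) :
    MellinRep c (expKernel a) fun s => Complex.Gamma (a - s) := by
  have hI : Integrable fun t : ℝ => Complex.Gamma (((a - c : ℝ) : ℂ) + (t : ℂ) * Complex.I) :=
    integrable_Gamma_vertical (sub_pos.2 hc)
  have hcongr : ∀ (s : ℂ), ∀ x ∈ Set.Ioi (0 : ℝ),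
      (x : ℂ) ^ (s - 1) • ((expKernel a x : ℝ) : ℂ) =
        (Real.exp (-x) : ℂ) * (x : ℂ) ^ (a + s - 1) := by
    intro s x (hx : 0 < x)
    rw [expKernel, Complex.ofReal_mul, Complex.ofReal_cpow hx.le, smul_eq_mul, add_sub_assoc,
      Complex.cpow_add _ _ (by exact_mod_cast hx.ne')]
    ring
  have hmel : ∀ s : ℂ, 0 < a + s.re →
      mellin (fun x => (expKernel a x : ℂ)) s = Complex.Gamma (a + s) := by
    intro s hs
    rw [mellin, setIntegral_congr_fun measurableSet_Ioi (hcongr s),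
      Complex.Gamma_eq_integral (by simpa using hs), Complex.GammaIntegral]
  refine ⟨?_, fun z hz => ?_⟩
  · convert hI.comp_neg using 2 with t
    push_cast; ring_nf
  · have key := mellinInv_mellin_eq (-c) (fun x => (expKernel a x : ℂ)) hz ?_ ?_ ?_
    · rw [← key, mellinInv, Complex.real_smul]
      push_cast
      congr 1
      -- `mellinInv` uses `z ^ (-s)`, here on the line `Re s = -c`; reflecting `t` turns this into
      -- `z ^ s` on `Re s = c`.
      rw [← integral_neg_eq_self]
      refine integral_congr_ae (ae_of_all _ fun t => ?_)
      simp only [smul_eq_mul]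
      rw [hmel _ (by simp; linarith), mul_comm]
      push_cast; ring_nf
    · have := Complex.GammaIntegral_convergent (s := a + (-c : ℝ)) (by simpa using hc)
      rw [MellinConvergent]
      exact this.congr_fun (fun x hx => (hcongr _ x hx).symm) measurableSet_Ioi
    · refine hI.congr (ae_of_all _ fun t => ?_)
      simp only
      rw [hmel _ (by simp; linarith)]
      push_cast; ring_nf
    · refine Complex.continuous_ofReal.continuousAt.comp ?_
      unfold expKernel
      exact (Real.continuousAt_rpow_const _ _ (Or.inl hz.ne')).mul (by fun_prop)

/-- Fubini's theorem for averages of dilations of an inverse Mellin transform. -/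
theorem MellinRep.average {c : ℝ} {k : ℝ → ℝ} {G : ℂ → ℂ} (h : MellinRep c k G)
    {X : Type*} [MeasurableSpace X] {ν : Measure X} [SFinite ν] {φ p : X → ℝ}
    (hφ : Measurable φ) (hp : Measurable p) (hpos : ∀ᵐ a ∂ν, 0 < p a)
    (hint : Integrable (fun a => φ a * p a ^ c) ν) :
    (∀ z, 0 < z → Integrable (fun a => φ a * k (z * p a)) ν) ∧
      MellinRep c (fun z => ∫ a, φ a * k (z * p a) ∂ν)
        (fun s => G s * ∫ a, (φ a : ℂ) * (p a : ℂ) ^ s ∂ν) := by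
  have hnorm : ∀ (t : ℝ) (z : ℝ), 0 < z → ‖(z : ℂ) ^ ((c : ℂ) + (t : ℂ) * Complex.I)‖ = z ^ c :=
    fun t z hz => by rw [Complex.norm_cpow_eq_rpow_re_of_pos hz]; simp
  have hF : ∀ z : ℝ, 0 < z → Integrable (fun x : X × ℝ => ((φ x.1 : ℂ) *
      (p x.1 : ℂ) ^ ((c : ℂ) + (x.2 : ℂ) * Complex.I)) * (G ((c : ℂ) + (x.2 : ℂ) * Complex.I) *
        (z : ℂ) ^ ((c : ℂ) + (x.2 : ℂ) * Complex.I))) (ν.prod volume) := by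
    intro z hz
    -- On the line the norms of `p ^ s` and `z ^ s` do not depend on `t`, so the integrand is
    -- dominated by a function of `a` times a function of `t`.
    have h1 : Integrable (fun x : X × ℝ => (φ x.1 * p x.1 ^ c) *
        (‖G ((c : ℂ) + (x.2 : ℂ) * Complex.I)‖ * z ^ c)) (ν.prod volume) :=
      hint.mul_prod (h.integrable.norm.mul_const _)
    refine h1.mono ?_ ?_
    · refine AEStronglyMeasurable.mul (Measurable.aestronglyMeasurable ?_)
        (AEStronglyMeasurable.mul ?_ (Measurable.aestronglyMeasurable ?_))
      · fun_prop
      · exact h.integrable.aestronglyMeasurable.comp_snd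
      · fun_prop
    · have : ∀ᵐ x ∂(ν.prod (volume : Measure ℝ)), 0 < p x.1 :=
        Measure.quasiMeasurePreserving_fst.ae hpos
      filter_upwards [this] with x hx
      rw [norm_mul, norm_mul, norm_mul, hnorm _ _ hx, hnorm _ _ hz, norm_mul, norm_mul, norm_mul]
      simp [abs_of_pos (Real.rpow_pos_of_pos hx c), abs_of_pos (Real.rpow_pos_of_pos hz c)]
  have hmulz : ∀ z : ℝ, 0 < z → ∀ y : ℝ, 0 < y → ∀ s : ℂ,
      ((z * y : ℝ) : ℂ) ^ s = (z : ℂ) ^ s * (y : ℂ) ^ s := fun z hz y hy s => by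
    rw [Complex.ofReal_mul, Complex.mul_cpow_ofReal_nonneg hz.le hy.le]
  have hinner : ∀ z : ℝ, 0 < z → ∀ᵐ a ∂ν, (1 / (2 * (Real.pi : ℂ))) * ∫ t : ℝ, ((φ a : ℂ) *
      (p a : ℂ) ^ ((c : ℂ) + (t : ℂ) * Complex.I)) * (G ((c : ℂ) + (t : ℂ) * Complex.I) *
        (z : ℂ) ^ ((c : ℂ) + (t : ℂ) * Complex.I)) = ((φ a * k (z * p a) : ℝ) : ℂ) := by
    intro z hz
    filter_upwards [hpos] with a ha
    rw [Complex.ofReal_mul, h.eq _ (mul_pos hz ha), mul_left_comm]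
    congr 1
    rw [← integral_const_mul]
    refine integral_congr_ae (ae_of_all _ fun t => ?_)
    simp only
    rw [hmulz z hz _ ha]
    ring
  refine ⟨fun z hz => ?_, ?_, fun z hz => ?_⟩
  · have := (((hF z hz).integral_prod_left.const_mul (1 / (2 * (Real.pi : ℂ)))).congr
      (hinner z hz)).re
    simpa using this
  · have := (hF 1 one_pos).integral_prod_right
    refine this.congr (ae_of_all _ fun t => ?_)
    simp only [Complex.ofReal_one, Complex.one_cpow, mul_one]
    rw [integral_mul_const, mul_comm]
  · rw [← integral_complex_ofReal, ← integral_congr_ae (hinner z hz), integral_const_mul,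
      integral_integral_swap (hF z hz)]
    congr 1
    refine integral_congr_ae (ae_of_all _ fun t => ?_)
    simp only
    rw [integral_mul_const]
    ring

theorem MellinRep.congr {c : ℝ} {k : ℝ → ℝ} {G G' : ℂ → ℂ} (h : MellinRep c k G)
    (hG : ∀ s : ℂ, s.re = c → G s = G' s) : MellinRep c k G' := by
  have hs : ∀ t : ℝ, G ((c : ℂ) + (t : ℂ) * Complex.I) = G' ((c : ℂ) + (t : ℂ) * Complex.I) :=
    fun t => hG _ (by simp)
  refine ⟨?_, fun z hz => ?_⟩
  · simpa only [hs] using h.integrable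
  · simpa only [hs] using h.eq z hz

/-! ### Bessel-type kernels and their gamma averages -/

/-- The multiplicative convolution of `expKernel a` and `expKernel b`. -/
noncomputable def prodKernel (a b w : ℝ) : ℝ :=
  ∫ y in Set.Ioi (0 : ℝ), y⁻¹ * expKernel a y * expKernel b (w * y⁻¹)

theorem measurable_prodKernel (a b : ℝ) : Measurable (prodKernel a b) := by
  have : Measurable fun x : ℝ × ℝ => x.2⁻¹ * expKernel a x.2 * expKernel b (x.1 * x.2⁻¹) :=
    (measurable_snd.inv.mul ((measurable_expKernel a).comp measurable_snd)).mul
      ((measurable_expKernel b).comp (measurable_fst.mul measurable_snd.inv))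
  exact (this.stronglyMeasurable.integral_prod_right
    (ν := volume.restrict (Set.Ioi 0))).measurable

theorem prodKernel_nonneg (a b : ℝ) {w : ℝ} (hw : 0 ≤ w) : 0 ≤ prodKernel a b w := by
  refine setIntegral_nonneg measurableSet_Ioi fun y (hy : 0 < y) => ?_
  have := expKernel_nonneg a hy.le
  have := expKernel_nonneg b (mul_nonneg hw (inv_nonneg.2 hy.le))
  positivity

/-- The kernel averages the dilations by `y⁻¹` of `expKernel b`, and the weight contributes `∫ y^(a
- s - 1) e^{-y} dy = Γ(a - s)`. The integrability half is reused for the law of a product of gamma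
variables. -/
theorem prodKernel_average {a b c : ℝ} (hca : c < a) (hcb : c < b) :
    (∀ z, 0 < z → Integrable (fun y => y⁻¹ * expKernel a y * expKernel b (z * y⁻¹))
      (volume.restrict (Set.Ioi 0))) ∧
    MellinRep c (prodKernel a b) fun s => Complex.Gamma (b - s) * Complex.Gamma (a - s) := by
  have hpos : ∀ᵐ y ∂(volume.restrict (Set.Ioi (0 : ℝ))), 0 < y⁻¹ := by
    filter_upwards [ae_restrict_mem measurableSet_Ioi] with y (hy : 0 < y)
    positivity
  have hint : Integrable (fun y : ℝ => y⁻¹ * expKernel a y * y⁻¹ ^ c)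
      (volume.restrict (Set.Ioi 0)) := by
    refine IntegrableOn.congr_fun (Real.GammaIntegral_convergent (sub_pos.2 hca)) ?_
      measurableSet_Ioi
    intro y (hy : 0 < y)
    simp only [expKernel]
    rw [Real.inv_rpow hy.le, ← Real.rpow_neg hy.le, ← Real.rpow_neg_one y, sub_right_comm,
      sub_eq_add_neg, sub_eq_add_neg, Real.rpow_add hy, Real.rpow_add hy]
    ring
  obtain ⟨h1, h2⟩ := (mellinRep_expKernel hcb).average
    (φ := fun y => y⁻¹ * expKernel a y) (p := fun y => y⁻¹)
    (measurable_inv.mul (measurable_expKernel a)) measurable_inv hpos hint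
  refine ⟨h1, h2.congr fun s hs => ?_⟩
  have hre : 0 < ((a : ℂ) - s).re := by simp [hs, hca]
  rw [Complex.Gamma_eq_integral hre, Complex.GammaIntegral]
  congr 1
  refine setIntegral_congr_fun measurableSet_Ioi fun y (hy : 0 < y) => ?_
  simp only [expKernel]
  have hy' : (y : ℂ) ≠ 0 := by exact_mod_cast hy.ne'
  rw [Complex.ofReal_inv, Complex.inv_cpow _ _ (by
      rw [Complex.arg_ofReal_of_nonneg hy.le]; exact Real.pi_pos.ne), ← Complex.cpow_neg,
    Complex.ofReal_mul, Complex.ofReal_mul, Complex.ofReal_cpow hy.le,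
    sub_right_comm, sub_eq_add_neg, sub_eq_add_neg,
    Complex.cpow_add _ _ hy', Complex.cpow_add _ _ hy', Complex.cpow_neg_one]
  push_cast
  ring

theorem mellinRep_prodKernel {a b c : ℝ} (hca : c < a) (hcb : c < b) :
    MellinRep c (prodKernel a b) fun s => Complex.Gamma (b - s) * Complex.Gamma (a - s) :=
  (prodKernel_average hca hcb).2

/-- The Bessel-type kernel with index difference `1/2` is elementary. -/
theorem prodKernel_add_half {α w : ℝ} (hw : 0 < w) :
    prodKernel α (α + 1 / 2) w =
      √Real.pi * 2 ^ (-(2 * α)) * expKernel (2 * α) (2 * √w) := by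
  have hca : α - 1 < α := by linarith
  have hsq : 0 < 2 * √w := by positivity
  apply Complex.ofReal_injective
  rw [(mellinRep_prodKernel hca (by linarith : α - 1 < α + 1 / 2)).eq w hw, Complex.ofReal_mul,
    (mellinRep_expKernel (by linarith : 2 * (α - 1) < 2 * α)).eq _ hsq]
  -- By duplication, `Γ(α - s) Γ(α - s + 1/2)` is `Γ(2α - 2s)` up to an exponential factor.
  -- Substituting `s ↦ 2s` carries the line `Re s = α - 1` to `Re s = 2(α - 1)`; its Jacobian `1/2`
  -- cancels the `2` in the constant of `e`. The abscissa `α - 1` is an arbitrary choice below `α`.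
  have hsub := Measure.integral_comp_mul_left (fun t : ℝ =>
    Complex.Gamma (((2 * α : ℝ) : ℂ) - (((2 * (α - 1) : ℝ) : ℂ) + (t : ℂ) * Complex.I)) *
      ((2 * √w : ℝ) : ℂ) ^ (((2 * (α - 1) : ℝ) : ℂ) + (t : ℂ) * Complex.I)) 2
  have e : ∀ t : ℝ, Complex.Gamma (((α + 1 / 2 : ℝ) : ℂ) - (((α - 1 : ℝ) : ℂ) + t * Complex.I)) *
      Complex.Gamma ((α : ℂ) - (((α - 1 : ℝ) : ℂ) + t * Complex.I)) *
      (w : ℂ) ^ (((α - 1 : ℝ) : ℂ) + t * Complex.I) =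
      (2 * (√Real.pi : ℂ) * ((2 ^ (-(2 * α)) : ℝ) : ℂ)) *
      (Complex.Gamma (((2 * α : ℝ) : ℂ) - (((2 * (α - 1) : ℝ) : ℂ) + ((2 * t : ℝ) : ℂ) * Complex.I)) *
      ((2 * √w : ℝ) : ℂ) ^ (((2 * (α - 1) : ℝ) : ℂ) + ((2 * t : ℝ) : ℂ) * Complex.I)) := by
    intro t
    set s := ((α - 1 : ℝ) : ℂ) + t * Complex.I with hs
    have hd := Complex.Gamma_mul_Gamma_add_half ((α : ℂ) - s)
    have e1 : ((2 * (α - 1) : ℝ) : ℂ) + ((2 * t : ℝ) : ℂ) * Complex.I = 2 * s := by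
      rw [hs]; push_cast; ring
    have e2 : ((α + 1 / 2 : ℝ) : ℂ) - s = (α : ℂ) - s + 1 / 2 := by push_cast; ring
    have e3 : (w : ℂ) ^ s = ((√w : ℝ) : ℂ) ^ (2 * s) := by
      have : (w : ℂ) = ((√w : ℝ) : ℂ) * ((√w : ℝ) : ℂ) := by
        rw [← Complex.ofReal_mul, Real.mul_self_sqrt hw.le]
      conv_lhs => rw [this]
      rw [Complex.mul_cpow_ofReal_nonneg (Real.sqrt_nonneg _) (Real.sqrt_nonneg _),
        ← Complex.cpow_add _ _ (by exact_mod_cast (Real.sqrt_pos.2 hw).ne'), two_mul]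
    have e4 : (2 : ℂ) ^ (1 - 2 * ((α : ℂ) - s)) =
        2 * ((2 ^ (-(2 * α)) : ℝ) : ℂ) * (2 : ℂ) ^ (2 * s) := by
      rw [Complex.ofReal_cpow two_pos.le, show (1 : ℂ) - 2 * ((α : ℂ) - s) =
        1 + ((-(2 * α) : ℝ) : ℂ) + 2 * s by push_cast; ring, Complex.cpow_add _ _ two_ne_zero,
        Complex.cpow_add _ _ two_ne_zero, Complex.cpow_one]
      push_cast; ring
    rw [e1, e2, mul_comm (Complex.Gamma _) (Complex.Gamma _), hd, e3, e4,
      Complex.ofReal_mul 2 (√w)]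
    have e5 : (((2 : ℝ) : ℂ) * ((√w : ℝ) : ℂ)) ^ (2 * s) =
        (2 : ℂ) ^ (2 * s) * ((√w : ℝ) : ℂ) ^ (2 * s) := by
      rw [Complex.mul_cpow_ofReal_nonneg two_pos.le (Real.sqrt_nonneg _)]; norm_num
    rw [e5, show ((2 * α : ℝ) : ℂ) - 2 * s = 2 * ((α : ℂ) - s) by push_cast; ring]
    ring
  rw [integral_congr_ae (ae_of_all _ e), integral_const_mul, hsub]
  rw [Complex.real_smul]
  push_cast
  rw [abs_of_pos (by norm_num : (0 : ℝ) < 2⁻¹)]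
  push_cast
  ring

/-- The average of dilations of `prodKernel` against a gamma-type weight. -/
noncomputable def gammaAverage (a b k l w : ℝ) : ℝ :=
  ∫ u in Set.Ioi (0 : ℝ), u ^ (k - 1) * Real.exp (-(l * u)) * prodKernel a b (w * (u ^ 2 / 4))

theorem gammaAverage_average {a b c k l : ℝ} (hca : c < a) (hcb : c < b) (hk : 0 < k + 2 * c)
    (hl : 0 < l) :
    (∀ z, 0 < z → Integrable (fun u => u ^ (k - 1) * Real.exp (-(l * u)) *
      prodKernel a b (z * (u ^ 2 / 4))) (volume.restrict (Set.Ioi 0))) ∧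
    MellinRep c (gammaAverage a b k l) fun s => Complex.Gamma (b - s) * Complex.Gamma (a - s) *
      ((1 / 4 : ℂ) ^ s * ((1 / l : ℂ) ^ ((k : ℂ) + 2 * s) * Complex.Gamma ((k : ℂ) + 2 * s))) := by
  have hpos : ∀ᵐ u ∂(volume.restrict (Set.Ioi (0 : ℝ))), 0 < u ^ 2 / 4 := by
    filter_upwards [ae_restrict_mem measurableSet_Ioi] with y (hy : 0 < y)
    positivity
  have hint : Integrable (fun u : ℝ => u ^ (k - 1) * Real.exp (-(l * u)) * (u ^ 2 / 4) ^ c)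
      (volume.restrict (Set.Ioi 0)) := by
    refine IntegrableOn.congr_fun ((integrableOn_rpow_mul_exp_neg_mul_rpow (p := 1)
      (s := k + 2 * c - 1) (b := l) (by linarith) one_pos hl).mul_const ((1 / 4) ^ c)) ?_
      measurableSet_Ioi
    intro u (hu : 0 < u)
    simp only
    rw [div_eq_mul_one_div (u ^ 2), Real.mul_rpow (by positivity) (by norm_num),
      ← Real.rpow_natCast u 2, ← Real.rpow_mul hu.le, Real.rpow_one, add_sub_right_comm,
      Real.rpow_add hu]
    push_cast
    ring_nf
  obtain ⟨h1, h2⟩ := (mellinRep_prodKernel hca hcb).average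
    (φ := fun u => u ^ (k - 1) * Real.exp (-(l * u))) (p := fun u => u ^ 2 / 4)
    (by fun_prop) (by fun_prop) hpos hint
  refine ⟨h1, h2.congr fun s hs => ?_⟩
  congr 1
  have hre : 0 < ((k : ℂ) + 2 * s).re := by simp [hs, hk]
  rw [← Complex.integral_cpow_mul_exp_neg_mul_Ioi hre (r := l) hl, ← integral_const_mul]
  refine setIntegral_congr_fun measurableSet_Ioi fun u (hu : 0 < u) => ?_
  have hu' : (u : ℂ) ≠ 0 := by exact_mod_cast hu.ne'
  have e1 : ((u ^ 2 / 4 : ℝ) : ℂ) ^ s = (1 / 4 : ℂ) ^ s * (u : ℂ) ^ (2 * s) := by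
    rw [div_eq_mul_one_div, sq, Complex.ofReal_mul, Complex.mul_cpow_ofReal_nonneg (by positivity)
      (by norm_num), Complex.ofReal_mul, Complex.mul_cpow_ofReal_nonneg hu.le hu.le,
      ← Complex.cpow_add _ _ hu', two_mul, mul_comm]
    push_cast; rfl
  rw [e1, Complex.ofReal_mul, Complex.ofReal_cpow hu.le, add_sub_right_comm,
    Complex.cpow_add _ _ hu']
  push_cast
  ring

theorem mellinRep_gammaAverage {a b c k l : ℝ} (hca : c < a) (hcb : c < b) (hk : 0 < k + 2 * c)
    (hl : 0 < l) :
    MellinRep c (gammaAverage a b k l) fun s => Complex.Gamma (b - s) * Complex.Gamma (a - s) *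
      ((1 / 4 : ℂ) ^ s * ((1 / l : ℂ) ^ ((k : ℂ) + 2 * s) * Complex.Gamma ((k : ℂ) + 2 * s))) :=
  (gammaAverage_average hca hcb hk hl).2

/-- The gamma factor of the Mellin transform of `gammaAverage`, split by the duplication formula into
the two gamma factors of a Meijer G-function. -/
theorem gamma_factors_eq {k l z : ℝ} (hl : 0 < l) (hz : 0 < z) (s : ℂ) :
    ((1 / 4 : ℂ) ^ s * ((1 / l : ℂ) ^ ((k : ℂ) + 2 * s) * Complex.Gamma ((k : ℂ) + 2 * s))) *
      (z : ℂ) ^ s = ((2 ^ (k - 1) / (√Real.pi * l ^ k) : ℝ) : ℂ) *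
      (Complex.Gamma ((k : ℂ) / 2 + s) * Complex.Gamma ((k : ℂ) / 2 + s + 1 / 2) *
        ((z / l ^ 2 : ℝ) : ℂ) ^ s) := by
  have hl' : (l : ℂ) ≠ 0 := by exact_mod_cast hl.ne'
  have hpi : ((√Real.pi : ℝ) : ℂ) ≠ 0 := by
    exact_mod_cast (Real.sqrt_pos.2 Real.pi_pos).ne'
  rw [Complex.Gamma_mul_Gamma_add_half, show 2 * ((k : ℂ) / 2 + s) = (k : ℂ) + 2 * s by ring]
  have e0 : (1 / l : ℂ) ^ ((k : ℂ) + 2 * s) = (l : ℂ) ^ (-(k : ℂ)) * (l : ℂ) ^ (-(2 * s)) := by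
    rw [one_div, Complex.inv_cpow _ _ (by
      rw [Complex.arg_ofReal_of_nonneg hl.le]; exact Real.pi_pos.ne), ← Complex.cpow_neg, neg_add,
      Complex.cpow_add _ _ hl']
  have e1 : ((z / l ^ 2 : ℝ) : ℂ) ^ s = (z : ℂ) ^ s * (l : ℂ) ^ (-(2 * s)) := by
    rw [div_eq_mul_inv, Complex.ofReal_mul, Complex.mul_cpow_ofReal_nonneg hz.le (by positivity),
      Complex.ofReal_inv, Complex.inv_cpow _ _ (by
      rw [Complex.arg_ofReal_of_nonneg (by positivity)]; exact Real.pi_pos.ne),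
      ← Complex.cpow_neg, sq, Complex.ofReal_mul, Complex.mul_cpow_ofReal_nonneg hl.le hl.le,
      ← Complex.cpow_add _ _ hl']
    ring_nf
  have e2 : (2 : ℂ) ^ (1 - ((k : ℂ) + 2 * s)) = (2 : ℂ) ^ (1 - (k : ℂ)) * (1 / 4 : ℂ) ^ s := by
    have : (1 / 4 : ℂ) ^ s = (2 : ℂ) ^ (-(2 * s)) := by
      have h4 : (1 / 4 : ℂ) = (((2 : ℝ)⁻¹ : ℝ) : ℂ) * (((2 : ℝ)⁻¹ : ℝ) : ℂ) := by
        push_cast; norm_num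
      rw [h4, Complex.mul_cpow_ofReal_nonneg (by norm_num) (by norm_num), Complex.ofReal_inv,
        Complex.inv_cpow _ _ (by
        rw [Complex.arg_ofReal_of_nonneg (by norm_num)]; exact Real.pi_pos.ne),
        ← Complex.cpow_neg, ← Complex.cpow_add _ _ (by norm_num)]
      push_cast
      ring_nf
    rw [this, ← Complex.cpow_add _ _ two_ne_zero]
    ring_nf
  have e3 : ((2 ^ (k - 1) / (√Real.pi * l ^ k) : ℝ) : ℂ) * (2 : ℂ) ^ (1 - (k : ℂ)) *
      (√Real.pi : ℂ) = (l : ℂ) ^ (-(k : ℂ)) := by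
    rw [Complex.cpow_neg, ← neg_sub (k : ℂ) 1, Complex.cpow_neg]
    push_cast
    rw [Complex.ofReal_cpow hl.le, Complex.ofReal_cpow two_pos.le]
    have h2 : (2 : ℂ) ^ ((k : ℂ) - 1) ≠ 0 := by simp [Complex.cpow_eq_zero_iff]
    have hlk : (l : ℂ) ^ (k : ℂ) ≠ 0 := by simp [Complex.cpow_eq_zero_iff, hl']
    push_cast
    field_simp
  rw [e0, e1, e2, ← e3]
  ring

theorem measurable_gammaAverage (a b k l : ℝ) : Measurable (gammaAverage a b k l) := by
  have : Measurable fun x : ℝ × ℝ => x.2 ^ (k - 1) * Real.exp (-(l * x.2)) *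
      prodKernel a b (x.1 * (x.2 ^ 2 / 4)) :=
    Measurable.mul (by fun_prop) ((measurable_prodKernel a b).comp (by fun_prop))
  exact (this.stronglyMeasurable.integral_prod_right
    (ν := volume.restrict (Set.Ioi 0))).measurable

/-! ### Identification with Meijer G-functions -/

/-- Excludes the default value `0` of `meijerG`. The rightmost left-hand pole is at `(1/2 - q)/2 <
0`, to the left of the positive `a` and `b`. -/
theorem exists_separating_pdf {a b q : ℝ} (ha : 0 < a) (hb : 0 < b) (hq : 1 / 2 < q) :
    ∃ c : ℝ, MeijerSeparates 2 2
      ![(((3 / 2 - q) / 2 : ℝ) : ℂ), (((5 / 2 - q) / 2 : ℝ) : ℂ)] ![(a : ℂ), (b : ℂ)] c := by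
  obtain ⟨c, h1, h2⟩ := exists_between (show (5 / 2 - q) / 2 - 1 < min a b by
    rw [lt_min_iff]; constructor <;> linarith)
  rw [lt_min_iff] at h2
  refine ⟨c, ?_, ?_⟩
  · rw [Fin.forall_fin_two]; simp [h2]
  · rw [Fin.forall_fin_two]
    simp only [Matrix.cons_val_zero, Matrix.cons_val_one, Complex.ofReal_re]
    constructor <;> intro <;> linarith

/-- The parameter `1` adds a left-hand pole at `0`, which is now the rightmost one, so the line must
satisfy `0 < c`. -/
theorem exists_separating_cdf {a b q : ℝ} (ha : 0 < a) (hb : 0 < b) (hq : 1 / 2 < q) :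
    ∃ c : ℝ, MeijerSeparates 2 3
      ![1, (((3 / 2 - q) / 2 : ℝ) : ℂ), (((5 / 2 - q) / 2 : ℝ) : ℂ)] ![(a : ℂ), (b : ℂ), 0] c := by
  obtain ⟨c, h1, h2⟩ := exists_between (show 0 < min a b by
    rw [lt_min_iff]; constructor <;> linarith)
  rw [lt_min_iff] at h2
  refine ⟨c, ?_, ?_⟩
  · simp [Fin.forall_fin_succ, h2]
  · simp only [Fin.forall_fin_succ]
    simp [h1]
    constructor <;> linarith

/-- No contour shift is needed: whichever line `meijerG` picks, separation of the poles says exactly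
that `c < a`, `c < b` and `0 < k + 2c` (the remaining inequality being weaker), so the Mellin
representation holds on that line. -/
theorem gammaAverage_eq_meijerG {a b k l z : ℝ} (ha : 0 < a) (hb : 0 < b) (hk : 0 < k)
    (hl : 0 < l) (hz : 0 < z) :
    (gammaAverage a b k l z : ℂ) = ((2 ^ (k - 1) / (√Real.pi * l ^ k) : ℝ) : ℂ) *
      meijerG 2 2 ![(((3 / 2 - (k + 1 / 2)) / 2 : ℝ) : ℂ), (((5 / 2 - (k + 1 / 2)) / 2 : ℝ) : ℂ)]
        ![(a : ℂ), (b : ℂ)] ((z / l ^ 2 : ℝ) : ℂ) := by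
  have hex := exists_separating_pdf ha hb (show 1 / 2 < k + 1 / 2 by linarith)
  rw [meijerG, dif_pos hex]
  obtain ⟨hc1, hc2⟩ := hex.choose_spec
  generalize hex.choose = c at hc1 hc2 ⊢
  have hca : c < a := by simpa using hc1 0 (by norm_num)
  have hcb : c < b := by simpa using hc1 1 (by norm_num)
  have hck : 0 < k + 2 * c := by
    have := hc2 1 (by norm_num)
    simp only [Matrix.cons_val_one, Matrix.cons_val_zero, Complex.ofReal_re] at this
    linarith
  rw [(mellinRep_gammaAverage hca hcb hck hl).eq z hz, mul_left_comm]
  congr 1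
  rw [← integral_const_mul]
  refine integral_congr_ae (ae_of_all _ fun t => ?_)
  simp only
  rw [mul_assoc, gamma_factors_eq hl hz]
  simp only [meijerIntegrand, Fin.prod_univ_two, Fin.val_zero, Fin.val_one, Matrix.cons_val_zero,
    Matrix.cons_val_one, Nat.zero_lt_two, Nat.one_lt_two, if_true]
  rw [show (1 : ℂ) - (((3 / 2 - (k + 1 / 2)) / 2 : ℝ) : ℂ) + ((c : ℂ) + t * Complex.I) =
    (k : ℂ) / 2 + ((c : ℂ) + t * Complex.I) + 1 / 2 by push_cast; ring,
    show (1 : ℂ) - (((5 / 2 - (k + 1 / 2)) / 2 : ℝ) : ℂ) + ((c : ℂ) + t * Complex.I) =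
    (k : ℂ) / 2 + ((c : ℂ) + t * Complex.I) by push_cast; ring]
  ring

theorem integral_gammaAverage_eq_meijerG {a b k l z x : ℝ} (ha : 0 < a) (hb : 0 < b) (hk : 0 < k)
    (hl : 0 < l) (hz : 0 < z) (hx : 0 < x) :
    IntegrableOn (fun t => t⁻¹ * gammaAverage a b k l (z * t)) (Set.Ioc 0 x) ∧
    ((∫ t in Set.Ioc 0 x, t⁻¹ * gammaAverage a b k l (z * t) : ℝ) : ℂ) =
      ((2 ^ (k - 1) / (√Real.pi * l ^ k) : ℝ) : ℂ) *
      meijerG 2 3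
        ![1, (((3 / 2 - (k + 1 / 2)) / 2 : ℝ) : ℂ), (((5 / 2 - (k + 1 / 2)) / 2 : ℝ) : ℂ)]
        ![(a : ℂ), (b : ℂ), 0] ((z * x / l ^ 2 : ℝ) : ℂ) := by
  have hex := exists_separating_cdf ha hb (show 1 / 2 < k + 1 / 2 by linarith)
  rw [meijerG, dif_pos hex]
  obtain ⟨hc1, hc2⟩ := hex.choose_spec
  generalize hex.choose = c at hc1 hc2 ⊢
  have hca : c < a := by simpa using hc1 0 (by norm_num)
  have hcb : c < b := by simpa using hc1 1 (by norm_num)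
  have hc0 : 0 < c := by simpa using hc2 0 (by norm_num)
  have hck : 0 < k + 2 * c := by linarith
  have hpos : ∀ᵐ t ∂(volume.restrict (Set.Ioc 0 x)), 0 < t := by
    filter_upwards [ae_restrict_mem measurableSet_Ioc] with y hy using hy.1
  have hint : Integrable (fun t : ℝ => t⁻¹ * t ^ c) (volume.restrict (Set.Ioc 0 x)) := by
    have := (intervalIntegral.intervalIntegrable_rpow' (a := 0) (b := x)
      (by linarith : -1 < c - 1))
    rw [intervalIntegrable_iff_integrableOn_Ioc_of_le hx.le] at this
    refine this.congr_fun (fun t ht => ?_) measurableSet_Ioc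
    simp only
    rw [Real.rpow_sub ht.1, Real.rpow_one]; ring
  obtain ⟨h1, h2⟩ := (mellinRep_gammaAverage hca hcb hck hl).average
    (φ := fun t => t⁻¹) (p := fun t => t) measurable_inv measurable_id hpos hint
  refine ⟨h1 z hz, ?_⟩
  rw [h2.eq z hz, mul_left_comm]
  congr 1
  rw [← integral_const_mul]
  refine integral_congr_ae (ae_of_all _ fun t => ?_)
  simp only
  set s := (c : ℂ) + t * Complex.I with hs
  have hsre : s.re = c := by simp [hs]
  have hs0 : s ≠ 0 := fun h => by rw [h] at hsre; simp at hsre; linarith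
  -- Convergence at `0` relies on `0 < c`, which the pole at `0` forces.
  have hI : ∫ y in Set.Ioc 0 x, ((y⁻¹ : ℝ) : ℂ) * (y : ℂ) ^ s = (x : ℂ) ^ s / s := by
    have := integral_cpow (a := 0) (b := x) (r := s - 1) (Or.inl (by simp [hsre, hc0]))
    rw [intervalIntegral.integral_of_le hx.le, sub_add_cancel, Complex.ofReal_zero,
      Complex.zero_cpow hs0, sub_zero] at this
    rw [← this]
    refine setIntegral_congr_fun measurableSet_Ioc fun y hy => ?_
    rw [Complex.cpow_sub _ _ (by exact_mod_cast hy.1.ne'), Complex.cpow_one]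
    push_cast; ring
  rw [hI]
  have hfac := gamma_factors_eq (k := k) hl (mul_pos hz hx) s
  rw [Complex.ofReal_mul z x, Complex.mul_cpow_ofReal_nonneg hz.le hx.le] at hfac
  simp only [meijerIntegrand, Fin.prod_univ_three, Fin.val_zero, Fin.val_one, Fin.val_two,
    Matrix.cons_val_zero, Matrix.cons_val_one, Matrix.cons_val_two, Nat.zero_lt_two,
    Nat.one_lt_two, if_true, lt_irrefl, if_false, Matrix.tail_cons, Matrix.head_cons]
  norm_num only [if_true]
  rw [show (1 : ℂ) - (((3 / 2 - (k + 1 / 2)) / 2 : ℝ) : ℂ) + s =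
    (k : ℂ) / 2 + s + 1 / 2 by push_cast; ring,
    show (1 : ℂ) - (((5 / 2 - (k + 1 / 2)) / 2 : ℝ) : ℂ) + s =
    (k : ℂ) / 2 + s by push_cast; ring]
  -- These are the factors of the additional parameters: lower `0` and upper `1`.
  have hG : (Complex.Gamma (1 + s))⁻¹ * Complex.Gamma (0 + s) = 1 / s := by
    have : Complex.Gamma s ≠ 0 := Complex.Gamma_ne_zero_of_re_pos (by rw [hsre]; exact hc0)
    rw [add_comm 1 s, Complex.Gamma_add_one s hs0, zero_add]
    field_simp
  calc _ = Complex.Gamma (b - s) * Complex.Gamma (a - s) * (1 / s) *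
      ((1 / 4 : ℂ) ^ s * ((1 / l : ℂ) ^ ((k : ℂ) + 2 * s) * Complex.Gamma ((k : ℂ) + 2 * s)) *
        ((z : ℂ) ^ s * (x : ℂ) ^ s)) := by ring
    _ = _ := by rw [hfac, ← hG]; ring

/-! ### Laws with a density with respect to `dx / x` -/

/-- The measure on `(0, ∞)` with density `k` with respect to `dx / x`. -/
noncomputable def mulDensity (k : ℝ → ℝ) : Measure ℝ :=
  (volume.restrict (Set.Ioi 0)).withDensity fun x => ENNReal.ofReal (x⁻¹ * k x)

theorem mulDensity_congr {k k' : ℝ → ℝ} (h : ∀ x, 0 < x → k x = k' x) :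
    mulDensity k = mulDensity k' := by
  refine withDensity_congr_ae ?_
  filter_upwards [ae_restrict_mem measurableSet_Ioi] with x (hx : 0 < x)
  rw [h x hx]

theorem ae_pos_mulDensity (k : ℝ → ℝ) : ∀ᵐ x ∂(mulDensity k), 0 < x :=
  (withDensity_absolutelyContinuous _ _).ae_le (ae_restrict_mem measurableSet_Ioi)

theorem mulDensity_singleton (k : ℝ → ℝ) (x : ℝ) : mulDensity k {x} = 0 :=
  withDensity_absolutelyContinuous _ _
    (Measure.absolutelyContinuous_of_le Measure.restrict_le_self (measure_singleton x))

theorem mulDensity_apply (k : ℝ → ℝ) {B : Set ℝ} (hB : MeasurableSet B) :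
    mulDensity k B = ∫⁻ x in Set.Ioi 0,
      B.indicator (fun x => ENNReal.ofReal (x⁻¹ * k x)) x := by
  rw [mulDensity, withDensity_apply _ hB, lintegral_indicator hB]

/-- In the coordinate `log x` a power map is linear, hence the constant Jacobian. -/
theorem map_rpow_mulDensity (k : ℝ → ℝ) {p : ℝ} (hp : p ≠ 0) :
    (mulDensity k).map (fun x => x ^ p) = mulDensity fun x => |p|⁻¹ * k (x ^ p⁻¹) := by
  ext B hB
  have hm : Measurable fun x : ℝ => x ^ p := by fun_prop
  rw [Measure.map_apply hm hB, mulDensity_apply _ (hm hB), mulDensity_apply _ hB]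
  have himg : (fun x : ℝ => x ^ p) '' Set.Ioi 0 = Set.Ioi 0 := by
    ext x
    refine ⟨?_, fun (hx : 0 < x) => ⟨x ^ p⁻¹, Real.rpow_pos_of_pos hx _, ?_⟩⟩
    · rintro ⟨y, hy : 0 < y, rfl⟩
      exact Real.rpow_pos_of_pos hy _
    · simp only
      rw [← Real.rpow_mul hx.le, inv_mul_cancel₀ hp, Real.rpow_one]
  have hinj : Set.InjOn (fun x : ℝ => x ^ p) (Set.Ioi 0) := fun x (hx : 0 < x) y (hy : 0 < y) h => by
    simp only at h
    rw [← Real.rpow_rpow_inv hx.le hp, h, Real.rpow_rpow_inv hy.le hp]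
  conv_rhs => rw [← himg]
  rw [lintegral_image_eq_lintegral_abs_deriv_mul measurableSet_Ioi
    (fun x (hx : 0 < x) => (Real.hasDerivAt_rpow_const (p := p) (Or.inl hx.ne')).hasDerivWithinAt)
    hinj]
  refine setLIntegral_congr_fun measurableSet_Ioi fun x (hx : 0 < x) => ?_
  by_cases hxB : x ^ p ∈ B
  · rw [Set.indicator_of_mem hxB, Set.indicator_of_mem (show x ∈ (fun x : ℝ => x ^ p) ⁻¹' B from hxB),
      ← ENNReal.ofReal_mul (abs_nonneg _), Real.rpow_rpow_inv hx.le hp, abs_mul,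
      abs_of_pos (Real.rpow_pos_of_pos hx _), Real.rpow_sub hx, Real.rpow_one]
    have h1 : x ^ p ≠ 0 := (Real.rpow_pos_of_pos hx _).ne'
    have h2 : |p| ≠ 0 := abs_ne_zero.2 hp
    congr 1
    field_simp
  · rw [Set.indicator_of_notMem hxB,
      Set.indicator_of_notMem (show x ∉ (fun x : ℝ => x ^ p) ⁻¹' B from hxB), mul_zero]

theorem map_mul_left_mulDensity (k : ℝ → ℝ) {r : ℝ} (hr : 0 < r) :
    (mulDensity k).map (fun x => r * x) = mulDensity fun x => k (x * r⁻¹) := by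
  ext B hB
  have hm : Measurable fun x : ℝ => r * x := by fun_prop
  rw [Measure.map_apply hm hB, mulDensity_apply _ (hm hB), mulDensity_apply _ hB]
  have himg : (fun x : ℝ => r * x) '' Set.Ioi 0 = Set.Ioi 0 := by
    ext x
    refine ⟨?_, fun (hx : 0 < x) => ⟨r⁻¹ * x, mul_pos (inv_pos.2 hr) hx, ?_⟩⟩
    · rintro ⟨y, hy : 0 < y, rfl⟩
      exact mul_pos hr hy
    · simp only
      rw [mul_inv_cancel_left₀ hr.ne']
  conv_rhs => rw [← himg]
  rw [lintegral_image_eq_lintegral_abs_deriv_mul (f' := fun _ => r) measurableSet_Ioi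
    (fun x (hx : 0 < x) => by simpa using ((hasDerivAt_id x).const_mul r).hasDerivWithinAt)
    (mul_right_injective₀ hr.ne').injOn]
  refine setLIntegral_congr_fun measurableSet_Ioi fun x (hx : 0 < x) => ?_
  by_cases hxB : r * x ∈ B
  · rw [Set.indicator_of_mem hxB, Set.indicator_of_mem (show x ∈ (fun x : ℝ => r * x) ⁻¹' B from hxB),
      ← ENNReal.ofReal_mul (abs_nonneg _), abs_of_pos hr]
    congr 1
    rw [mul_comm r x, mul_inv_cancel_right₀ hr.ne']
    field_simp
  · rw [Set.indicator_of_notMem hxB,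
      Set.indicator_of_notMem (show x ∉ (fun x : ℝ => r * x) ⁻¹' B from hxB), mul_zero]

/-- Tonelli's theorem for mixtures of dilations of a measure with density on `(0, ∞)`. -/
theorem lintegral_mulDensity_preimage {X : Type*} [MeasurableSpace X] {P : Measure X} [SFinite P]
    {k : ℝ → ℝ} (hk : Measurable k) {p : X → ℝ} (hp : Measurable p) (hpos : ∀ᵐ a ∂P, 0 < p a)
    {B : Set ℝ} (hB : MeasurableSet B) :
    ∫⁻ a, mulDensity k {y | p a * y ∈ B} ∂P =
      (volume.restrict (Set.Ioi 0)).withDensity (fun x => ENNReal.ofReal x⁻¹ *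
        ∫⁻ a, ENNReal.ofReal (k (x * (p a)⁻¹)) ∂P) B := by
  have h1 : ∀ᵐ a ∂P, mulDensity k {y | p a * y ∈ B} = ∫⁻ x in Set.Ioi 0,
      B.indicator 1 x * (ENNReal.ofReal x⁻¹ * ENNReal.ofReal (k (x * (p a)⁻¹))) := by
    filter_upwards [hpos] with a ha
    have hm : Measurable fun x : ℝ => p a * x := by fun_prop
    rw [show {y | p a * y ∈ B} = (fun x => p a * x) ⁻¹' B from rfl, ← Measure.map_apply hm hB,
      map_mul_left_mulDensity _ ha, mulDensity_apply _ hB]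
    refine setLIntegral_congr_fun measurableSet_Ioi fun x (hx : 0 < x) => ?_
    by_cases hxB : x ∈ B
    · simp [hxB, ENNReal.ofReal_mul (inv_nonneg.2 hx.le)]
    · simp [hxB]
  have hmk : Measurable fun x : X × ℝ => ENNReal.ofReal (k (x.2 * (p x.1)⁻¹)) := by fun_prop
  have hmI : Measurable fun x : X × ℝ => B.indicator (1 : ℝ → ENNReal) x.2 :=
    (measurable_one.indicator hB).comp measurable_snd
  rw [lintegral_congr_ae h1, lintegral_lintegral_swap (by
      refine (hmI.mul (Measurable.mul (by fun_prop) hmk)).aemeasurable),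
    withDensity_apply _ hB, ← lintegral_indicator hB]
  refine lintegral_congr fun x => ?_
  have hmx : Measurable fun a : X => ENNReal.ofReal (k (x * (p a)⁻¹)) := by fun_prop
  rw [lintegral_const_mul _ (hmx.const_mul _), lintegral_const_mul _ hmx]
  by_cases hxB : x ∈ B <;> simp [hxB]

/-- Given the value of `X`, the product is a dilation of `Y`, and dilations preserve `dx / x`;
averaging over `X` yields the multiplicative convolution. -/
theorem map_mul_mulDensity {Ω : Type*} [MeasurableSpace Ω] {μ : Measure Ω}
    [IsProbabilityMeasure μ] {X Y : Ω → ℝ} (hX : AEMeasurable X μ) (hY : AEMeasurable Y μ)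
    (hXY : IndepFun X Y μ) {k k' : ℝ → ℝ} (hk : Measurable k) (hk' : Measurable k')
    (hk0 : ∀ x, 0 < x → 0 ≤ k x) (hk0' : ∀ x, 0 < x → 0 ≤ k' x)
    (hint : ∀ z, 0 < z → Integrable (fun y => y⁻¹ * k y * k' (z * y⁻¹))
      (volume.restrict (Set.Ioi 0)))
    (hlX : μ.map X = mulDensity k) (hlY : μ.map Y = mulDensity k') :
    μ.map (fun ω => X ω * Y ω) =
      mulDensity fun x => ∫ y in Set.Ioi 0, y⁻¹ * k y * k' (x * y⁻¹) := by
  have : IsProbabilityMeasure (μ.map X) := Measure.isProbabilityMeasure_map hX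
  have : IsProbabilityMeasure (μ.map Y) := Measure.isProbabilityMeasure_map hY
  have hprod := (indepFun_iff_map_prod_eq_prod_map_map hX hY).1 hXY
  ext B hB
  have hB' : MeasurableSet {x : ℝ × ℝ | x.1 * x.2 ∈ B} := measurable_mul hB
  rw [Measure.map_apply_of_aemeasurable (hX.fun_mul hY) hB]
  have e1 : μ ((fun ω => X ω * Y ω) ⁻¹' B) =
      μ.map (fun ω => (X ω, Y ω)) {x : ℝ × ℝ | x.1 * x.2 ∈ B} := by
    rw [Measure.map_apply_of_aemeasurable (hX.prodMk hY) hB']; rfl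
  rw [e1, hprod, Measure.prod_apply hB']
  simp only [Set.preimage_ofPred_eq]
  have hpos : ∀ᵐ a ∂(μ.map X), 0 < a := hlX ▸ ae_pos_mulDensity k
  rw [hlY, lintegral_mulDensity_preimage hk' (p := fun a => a) measurable_id hpos hB, mulDensity]
  congr 1
  refine withDensity_congr_ae ?_
  filter_upwards [ae_restrict_mem measurableSet_Ioi] with x (hx : 0 < x)
  rw [ENNReal.ofReal_mul (inv_nonneg.2 hx.le), hlX, mulDensity, lintegral_withDensity_eq_lintegral_mul
    _ (by fun_prop) (by fun_prop), ofReal_integral_eq_lintegral_ofReal (hint x hx)]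
  · congr 1
    refine setLIntegral_congr_fun measurableSet_Ioi fun y (hy : 0 < y) => ?_
    simp only [Pi.mul_apply]
    rw [← ENNReal.ofReal_mul (mul_nonneg (inv_nonneg.2 hy.le) (hk0 y hy))]
  · filter_upwards [ae_restrict_mem measurableSet_Ioi] with y (hy : 0 < y)
    exact mul_nonneg (mul_nonneg (inv_nonneg.2 hy.le) (hk0 y hy))
      (hk0' _ (mul_pos hx (inv_pos.2 hy)))

theorem withDensity_ofReal_eq_mulDensity {f k : ℝ → ℝ} (h0 : ∀ x < 0, f x = 0)
    (h : ∀ x, 0 < x → f x = x⁻¹ * k x) :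
    volume.withDensity (fun x => ENNReal.ofReal (f x)) = mulDensity k := by
  rw [mulDensity, ← withDensity_indicator measurableSet_Ioi]
  refine withDensity_congr_ae ?_
  have : ∀ᵐ x : ℝ, x ≠ 0 := by simp [ae_iff, measure_singleton]
  filter_upwards [this] with x hx
  rcases hx.lt_or_gt with hx | hx
  · simp [h0 x hx, hx.le]
  · simp [h x hx, hx]

/-! ### Products of gamma and inverse-gamma variables -/

theorem gammaMeasure_eq_mulDensity {a r : ℝ} (hr : 0 < r) :
    gammaMeasure a r = mulDensity fun x => expKernel a (r * x) / Real.Gamma a := by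
  refine withDensity_ofReal_eq_mulDensity (fun x hx => ?_) fun x hx => ?_
  · rw [gammaPDFReal, if_neg (not_le.2 hx)]
  · rw [gammaPDFReal, if_pos hx.le, expKernel, Real.mul_rpow hr.le hx.le, Real.rpow_sub hx,
      Real.rpow_one]
    ring

theorem invGammaMeasure_eq_mulDensity {a g : ℝ} (hg : 0 < g) :
    invGammaMeasure a g = mulDensity fun x => expKernel a (g * x⁻¹) / Real.Gamma a := by
  refine withDensity_ofReal_eq_mulDensity (fun x hx => ?_) fun x hx => ?_
  · rw [invGammaPDFReal, if_neg (not_lt.2 hx.le)]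
  · rw [invGammaPDFReal, if_pos hx, expKernel, Real.mul_rpow hg.le (inv_nonneg.2 hx.le),
      Real.rpow_add hx, Real.rpow_one, Real.inv_rpow hx.le, div_eq_mul_inv g x]
    field_simp

/-- The law of a product of two independent gamma variables of rate `1`. -/
theorem map_mul_gamma {Ω : Type*} [MeasurableSpace Ω] {μ : Measure Ω}
    [IsProbabilityMeasure μ] {X Y : Ω → ℝ} (hX : AEMeasurable X μ) (hY : AEMeasurable Y μ)
    (hXY : IndepFun X Y μ) {a b : ℝ} (ha : 0 < a) (hb : 0 < b)
    (hlX : μ.map X = mulDensity fun x => expKernel a x / Real.Gamma a)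
    (hlY : μ.map Y = mulDensity fun x => expKernel b x / Real.Gamma b) :
    μ.map (fun ω => X ω * Y ω) =
      mulDensity fun x => prodKernel a b x / (Real.Gamma a * Real.Gamma b) := by
  obtain ⟨c, _, h2⟩ := exists_between (show min a b - 1 < min a b by linarith)
  rw [lt_min_iff] at h2
  have hga := Real.Gamma_pos_of_pos ha
  have hgb := Real.Gamma_pos_of_pos hb
  have e : ∀ z y : ℝ, y⁻¹ * (expKernel a y / Real.Gamma a) *
      (expKernel b (z * y⁻¹) / Real.Gamma b) =
      (y⁻¹ * expKernel a y * expKernel b (z * y⁻¹)) / (Real.Gamma a * Real.Gamma b) :=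
    fun z y => by ring
  rw [map_mul_mulDensity hX hY hXY ((measurable_expKernel a).div_const _)
    ((measurable_expKernel b).div_const _)
    (fun x hx => div_nonneg (expKernel_nonneg a hx.le) hga.le)
    (fun x hx => div_nonneg (expKernel_nonneg b hx.le) hgb.le) ?_ hlX hlY]
  · refine mulDensity_congr fun x hx => ?_
    simp only [e]
    rw [integral_div, prodKernel]
  · intro z hz
    simp only [e]
    exact ((prodKernel_average h2.1 h2.2).1 z hz).div_const _

theorem map_mul_left_of_map_eq_mulDensity {Ω : Type*} [MeasurableSpace Ω] {μ : Measure Ω}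
    {X : Ω → ℝ} (hX : AEMeasurable X μ) {k : ℝ → ℝ} (hl : μ.map X = mulDensity k) {r : ℝ}
    (hr : 0 < r) : μ.map (fun ω => r * X ω) = mulDensity fun x => k (x * r⁻¹) := by
  rw [← map_mul_left_mulDensity k hr, ← hl,
    AEMeasurable.map_map_of_aemeasurable (by fun_prop) hX]; rfl

theorem map_rpow_of_map_eq_mulDensity {Ω : Type*} [MeasurableSpace Ω] {μ : Measure Ω}
    {X : Ω → ℝ} (hX : AEMeasurable X μ) {k : ℝ → ℝ} (hl : μ.map X = mulDensity k) {p : ℝ}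
    (hp : p ≠ 0) : μ.map (fun ω => X ω ^ p) = mulDensity fun x => |p|⁻¹ * k (x ^ p⁻¹) := by
  rw [← map_rpow_mulDensity k hp, ← hl,
    AEMeasurable.map_map_of_aemeasurable (by fun_prop) hX]; rfl

/-- The law of a product of two independent gamma variables of arbitrary rates. -/
theorem map_mul_of_hasLaw_gamma {Ω : Type*} [MeasurableSpace Ω] {μ : Measure Ω}
    [IsProbabilityMeasure μ] {X Y : Ω → ℝ} (hXY : IndepFun X Y μ) {a b r s : ℝ} (ha : 0 < a)
    (hb : 0 < b) (hr : 0 < r) (hs : 0 < s) (hlX : HasLaw X (gammaMeasure a r) μ)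
    (hlY : HasLaw Y (gammaMeasure b s) μ) :
    μ.map (fun ω => X ω * Y ω) =
      mulDensity fun x => prodKernel a b (r * s * x) / (Real.Gamma a * Real.Gamma b) := by
  have hX := hlX.aemeasurable
  have hY := hlY.aemeasurable
  have e1 := map_mul_left_of_map_eq_mulDensity hX
    (hlX.map_eq.trans (gammaMeasure_eq_mulDensity hr)) hr
  have e2 := map_mul_left_of_map_eq_mulDensity hY
    (hlY.map_eq.trans (gammaMeasure_eq_mulDensity hs)) hs
  have hc : ∀ {t : ℝ}, 0 < t → ∀ x, t * (x * t⁻¹) = x := fun ht x => by field_simp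
  simp only [hc hr] at e1
  simp only [hc hs] at e2
  have hm := map_mul_gamma (hX.const_mul r) (hY.const_mul s)
    (hXY.comp (measurable_const_mul r) (measurable_const_mul s)) ha hb e1 e2
  have h3 := map_mul_left_of_map_eq_mulDensity ((hX.const_mul r).mul (hY.const_mul s)) hm
    (inv_pos.2 (mul_pos hr hs))
  have h4 : (fun ω => (r * s)⁻¹ * (r * X ω * (s * Y ω))) = fun ω => X ω * Y ω := by
    ext ω; field_simp
  simp only [Pi.mul_apply, h4, inv_inv] at h3
  rw [h3]
  refine mulDensity_congr fun x _ => ?_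
  rw [mul_comm x]

/-- A transform of the product of two independent inverse-gamma variables whose shapes differ by
`1/2` is gamma distributed. -/
theorem hasLaw_sqrt_of_invGamma {Ω : Type*} [MeasurableSpace Ω] {μ : Measure Ω}
    [IsProbabilityMeasure μ] {X Y : Ω → ℝ} (hXY : IndepFun X Y μ) {a g h : ℝ} (ha : 0 < a)
    (hg : 0 < g) (hh : 0 < h) (hlX : HasLaw X (invGammaMeasure a g) μ)
    (hlY : HasLaw Y (invGammaMeasure (a + 1 / 2) h) μ) :
    HasLaw (fun ω => 2 * ((g * X ω ^ (-1 : ℝ)) * (h * Y ω ^ (-1 : ℝ))) ^ (1 / 2 : ℝ))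
      (gammaMeasure (2 * a) 1) μ := by
  have hX := hlX.aemeasurable
  have hY := hlY.aemeasurable
  have hX1 : AEMeasurable (fun ω => X ω ^ (-1 : ℝ)) μ := hX.pow_const _
  have hY1 : AEMeasurable (fun ω => Y ω ^ (-1 : ℝ)) μ := hY.pow_const _
  have e1 := map_mul_left_of_map_eq_mulDensity hX1 (map_rpow_of_map_eq_mulDensity hX
    (hlX.map_eq.trans (invGammaMeasure_eq_mulDensity hg)) (by norm_num : (-1 : ℝ) ≠ 0)) hg
  have e2 := map_mul_left_of_map_eq_mulDensity hY1 (map_rpow_of_map_eq_mulDensity hY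
    (hlY.map_eq.trans (invGammaMeasure_eq_mulDensity hh)) (by norm_num : (-1 : ℝ) ≠ 0)) hh
  have hc : ∀ t : ℝ, 0 < t → ∀ b : ℝ, (mulDensity fun x => |(-1 : ℝ)|⁻¹ *
      (expKernel b (t * ((x * t⁻¹) ^ (-1 : ℝ)⁻¹)⁻¹) / Real.Gamma b)) =
      mulDensity fun x => expKernel b x / Real.Gamma b := fun t ht b => by
    refine mulDensity_congr fun x hx => ?_
    have : t * ((x * t⁻¹) ^ (-1 : ℝ)⁻¹)⁻¹ = x := by
      rw [show (-1 : ℝ)⁻¹ = -1 by norm_num, Real.rpow_neg_one, inv_inv]; field_simp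
    rw [this]; simp
  rw [hc g hg] at e1
  rw [hc h hh] at e2
  have hm := map_mul_gamma (hX1.const_mul g) (hY1.const_mul h)
    (hXY.comp (φ := fun x : ℝ => g * x ^ (-1 : ℝ)) (ψ := fun x : ℝ => h * x ^ (-1 : ℝ))
      (by fun_prop) (by fun_prop)) ha (by linarith) e1 e2
  have hXYm := (hX1.const_mul g).mul (hY1.const_mul h)
  have h3 := map_mul_left_of_map_eq_mulDensity (hXYm.pow_const (1 / 2 : ℝ))
    (map_rpow_of_map_eq_mulDensity hXYm hm (by norm_num : (1 / 2 : ℝ) ≠ 0)) two_pos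
  refine ⟨(hXYm.pow_const _).const_mul _, ?_⟩
  simp only [Pi.mul_apply] at h3
  rw [h3, gammaMeasure_eq_mulDensity one_pos]
  refine mulDensity_congr fun x hx => ?_
  -- Inverting `x = 2 √w` gives `w = (x / 2)²`, where the product kernel is elementary. Its constant
  -- `√π 2^(-2a)`, times the Jacobian factor `2`, cancels the one in `Γ(a) Γ(a + 1/2) = Γ(2a) 2^(1 -
  -- 2a) √π`.
  have hx2 : (x * 2⁻¹) ^ (1 / 2 : ℝ)⁻¹ = (x / 2) ^ 2 := by
    rw [show (1 / 2 : ℝ)⁻¹ = ((2 : ℕ) : ℝ) by norm_num, Real.rpow_natCast, div_eq_mul_inv]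
  rw [hx2, prodKernel_add_half (by positivity), Real.sqrt_sq (by positivity),
    Real.Gamma_mul_Gamma_add_half, one_mul, show 2 * (x / 2) = x by ring,
    show 1 - 2 * a = 1 + -(2 * a) by ring, Real.rpow_add two_pos, Real.rpow_one]
  have h1 : (0 : ℝ) < 2 ^ (-(2 * a)) := by positivity
  have h2 : 0 < √Real.pi := Real.sqrt_pos.2 Real.pi_pos
  have h5 : 0 < Real.Gamma (2 * a) := Real.Gamma_pos_of_pos (by linarith)
  rw [abs_of_pos (by norm_num : (0 : ℝ) < 1 / 2)]
  field_simp

/-! ### Independence and selection -/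

/-- Functions of disjoint blocks of an independent family are independent. -/
theorem iIndepFun_comp_blocks {Ω ι κ : Type*} [MeasurableSpace Ω] {μ : Measure Ω}
    {f : ι → Ω → ℝ} (hf : iIndepFun f μ) (hm : ∀ i, Measurable (f i)) (S : κ → Finset ι)
    (hS : Pairwise fun k l => Disjoint (S k) (S l)) (h : ∀ k, (S k → ℝ) → ℝ)
    (hh : ∀ k, Measurable (h k)) :
    iIndepFun (fun k ω => h k fun i => f i ω) μ := by
  classical
  have := hf.isProbabilityMeasure
  rw [iIndepFun_iff_measure_inter_preimage_eq_mul]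
  intro s sets hsets
  induction s using Finset.induction_on with
  | empty => simp
  | insert a s ha ih =>
    have ih' := ih fun i hi => hsets i (Finset.mem_insert_of_mem hi)
    rw [Finset.prod_insert ha, ← ih', Finset.set_biInter_insert]
    have hdisj : Disjoint (S a) (s.biUnion S) := by
      rw [Finset.disjoint_biUnion_right]
      intro k hk
      exact hS fun hak => ha (hak ▸ hk)
    -- The event for the indices in `s` depends only on the coordinates in the union of their
    -- blocks, which is disjoint from the new block.
    have hind := hf.indepFun_finset _ _ hdisj hm
    have hsub : ∀ k : s, S k ⊆ s.biUnion S := fun k => Finset.subset_biUnion_of_mem S k.2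
    let T : Set (s.biUnion S → ℝ) :=
      {v | ∀ k : s, h k (fun i => v ⟨i, hsub k i.2⟩) ∈ sets k}
    have hT : MeasurableSet T := by
      have : T = ⋂ k : s, (fun v : s.biUnion S → ℝ => h k (fun i => v ⟨i, hsub k i.2⟩)) ⁻¹' sets k := by
        ext v; simp [T]
      rw [this]
      refine MeasurableSet.iInter fun k => ?_
      exact ((hh k).comp (measurable_pi_lambda _ fun i => measurable_pi_apply _))
        (hsets k (Finset.mem_insert_of_mem k.2))
    have e : (⋂ k ∈ s, (fun ω => h k fun i => f i ω) ⁻¹' sets k) =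
        (fun ω (i : s.biUnion S) => f i ω) ⁻¹' T := by
      ext ω; simp [T]
    rw [e]
    exact hind.measure_inter_preimage_eq_mul _ _
      ((hh a) (hsets a (Finset.mem_insert_self _ _))) hT

section Selection

variable {Ω : Type*} [MeasurableSpace Ω] {μ : Measure Ω} [IsProbabilityMeasure μ] {L : ℕ}
  {N U : Fin L → Ω → ℝ} {lN lU : Measure ℝ}

/-- Given `U i = u`, the other `L - 1` values are i.i.d. and independent of `N i`. The set `C` is
kept general so that one computation covers both strict and weak minimality of `U i`. -/
theorem measure_block_inter (hind : iIndepFun (Sum.elim N U) μ)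
    (hN : ∀ i, Measurable (N i)) (hU : ∀ i, Measurable (U i)) (hlN : ∀ i, μ.map (N i) = lN)
    (hlU : ∀ i, μ.map (U i) = lU) {C : ℝ → Set ℝ} (hC : MeasurableSet {p : ℝ × ℝ | p.2 ∈ C p.1})
    {B : Set (ℝ × ℝ)} (hB : MeasurableSet B) (i : Fin L) :
    μ {ω | (N i ω, U i ω) ∈ B ∧ ∀ j, j ≠ i → U j ω ∈ C (U i ω)} =
      ∫⁻ u, lU (C u) ^ (L - 1) * lN {n | (n, u) ∈ B} ∂lU := by
  classical
  have hmV : ∀ k, Measurable (Sum.elim N U k) := by rintro (j | j); exacts [hN j, hU j]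
  have : IsProbabilityMeasure lN := hlN i ▸ Measure.isProbabilityMeasure_map (hN i).aemeasurable
  have : IsProbabilityMeasure lU := hlU i ▸ Measure.isProbabilityMeasure_map (hU i).aemeasurable
  let X : Ω → ℝ × ℝ := fun ω => (N i ω, U i ω)
  let Y : Ω → {j : Fin L // j ≠ i} → ℝ := fun ω j => U j ω
  have hX : Measurable X := (hN i).prodMk (hU i)
  have hY : Measurable Y := measurable_pi_lambda _ fun j => hU j
  have hXY : IndepFun X Y μ := by
    have h := hind.indepFun_finset {Sum.inl i, Sum.inr i}
      ((Finset.univ.erase i).image Sum.inr) (by simp [Finset.disjoint_left]) hmV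
    have hφ : Measurable fun v : ({Sum.inl i, Sum.inr i} : Finset (Fin L ⊕ Fin L)) → ℝ =>
        (v ⟨Sum.inl i, by simp⟩, v ⟨Sum.inr i, by simp⟩) := by fun_prop
    have hψ : Measurable fun (v : ((Finset.univ.erase i).image Sum.inr :
        Finset (Fin L ⊕ Fin L)) → ℝ) (j : {j : Fin L // j ≠ i}) =>
        v ⟨Sum.inr j, by simp [j.2]⟩ := by fun_prop
    exact h.comp hφ hψ
  have hmX : μ.map X = lN.prod lU := by
    have h : IndepFun (N i) (U i) μ := hind.indepFun (i := Sum.inl i) (j := Sum.inr i) (by simp)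
    rw [(indepFun_iff_map_prod_eq_prod_map_map (hN i).aemeasurable (hU i).aemeasurable).1 h,
      hlN, hlU]
  have hmY : μ.map Y = Measure.pi fun _ => lU := by
    have h := (hind.precomp (g := fun j : {j : Fin L // j ≠ i} => Sum.inr j.1)
      (Sum.inr_injective.comp Subtype.val_injective)).map_fun_eq_pi_map
      fun j => (hmV _).aemeasurable
    refine h.trans ?_
    congr 1
    ext1 j
    exact hlU j
  have hjoint := (indepFun_iff_map_prod_eq_prod_map_map hX.aemeasurable hY.aemeasurable).1 hXY
  let A : Set ((ℝ × ℝ) × ({j : Fin L // j ≠ i} → ℝ)) :=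
    {p | p.1 ∈ B ∧ ∀ j, p.2 j ∈ C p.1.2}
  have hA : MeasurableSet A := by
    refine (measurable_fst hB).inter ?_
    have : {p : (ℝ × ℝ) × ({j : Fin L // j ≠ i} → ℝ) | ∀ j, p.2 j ∈ C p.1.2} =
        ⋂ j, (fun p => (p.1.2, p.2 j)) ⁻¹' {p : ℝ × ℝ | p.2 ∈ C p.1} := by
      ext p; simp
    change MeasurableSet {p : (ℝ × ℝ) × ({j : Fin L // j ≠ i} → ℝ) | ∀ j, p.2 j ∈ C p.1.2}
    rw [this]
    exact MeasurableSet.iInter fun j => (by fun_prop : Measurable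
      fun p : (ℝ × ℝ) × ({j : Fin L // j ≠ i} → ℝ) => (p.1.2, p.2 j)) hC
  have e1 : μ {ω | (N i ω, U i ω) ∈ B ∧ ∀ j, j ≠ i → U j ω ∈ C (U i ω)} =
      μ.map (fun ω => (X ω, Y ω)) A := by
    rw [Measure.map_apply (hX.prodMk hY) hA]
    congr 1
    ext ω
    simp [A, X, Y]
  have hcard : Fintype.card {j : Fin L // j ≠ i} = L - 1 := by
    rw [Fintype.card_subtype_compl, Fintype.card_subtype_eq, Fintype.card_fin]
  have hmeasA := measurable_measure_prodMk_left (ν := Measure.pi fun _ => lU) hA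
  have e2 : ∀ p : ℝ × ℝ, (Measure.pi fun _ : {j : Fin L // j ≠ i} => lU) (Prod.mk p ⁻¹' A) =
      lU (C p.2) ^ (L - 1) * B.indicator 1 p := by
    intro p
    by_cases hp : p ∈ B
    · have : Prod.mk p ⁻¹' A = Set.univ.pi fun _ => C p.2 := by
        ext v; simp [A, hp]
      rw [this, Measure.pi_pi, Finset.prod_const, Finset.card_univ, hcard]
      simp [hp]
    · have : Prod.mk p ⁻¹' A = ∅ := by
        ext v; simp [A, hp]
      rw [this]; simp [hp]
  rw [e1, hjoint, hmX, hmY, Measure.prod_apply hA, lintegral_prod_symm _ hmeasA.aemeasurable]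
  refine lintegral_congr fun u => ?_
  have hBu : MeasurableSet {n | (n, u) ∈ B} :=
    (by fun_prop : Measurable fun n : ℝ => (n, u)) hB
  simp only [e2]
  have hmI : Measurable fun n : ℝ => B.indicator (1 : ℝ × ℝ → ENNReal) (n, u) :=
    (measurable_one.indicator hB).comp (by fun_prop)
  rw [lintegral_const_mul _ hmI]
  congr 1
  rw [← lintegral_indicator_one hBu]
  rfl

/-- The joint law of the selected pair, when the index minimizing `U` is selected. -/
theorem measure_selected (hind : iIndepFun (Sum.elim N U) μ)
    (hN : ∀ i, Measurable (N i)) (hU : ∀ i, Measurable (U i)) (hlN : ∀ i, μ.map (N i) = lN)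
    (hlU : ∀ i, μ.map (U i) = lU) (hatom : ∀ u, lU {u} = 0) {sel : Ω → Fin L}
    (hsel : Measurable sel) (hmin : ∀ᵐ ω ∂μ, ∀ j, U (sel ω) ω ≤ U j ω) {B : Set (ℝ × ℝ)}
    (hB : MeasurableSet B) :
    μ {ω | (N (sel ω) ω, U (sel ω) ω) ∈ B} =
      ∫⁻ u, L * (lU (Set.Ioi u) ^ (L - 1) * lN {n | (n, u) ∈ B}) ∂lU := by
  have hIci : ∀ u, lU (Set.Ici u) = lU (Set.Ioi u) := fun u => by
    refine le_antisymm ?_ (measure_mono Set.Ioi_subset_Ici_self)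
    rw [← Set.Ioi_union_left]
    refine (measure_union_le _ _).trans ?_
    rw [hatom, add_zero]
  have hi : ∀ i, μ (sel ⁻¹' {i} ∩ {ω | (N (sel ω) ω, U (sel ω) ω) ∈ B}) =
      ∫⁻ u, lU (Set.Ioi u) ^ (L - 1) * lN {n | (n, u) ∈ B} ∂lU := by
    intro i
    have h1 := measure_block_inter hind hN hU hlN hlU (C := Set.Ioi)
      (measurableSet_lt measurable_fst measurable_snd) hB i
    have h2 := measure_block_inter hind hN hU hlN hlU (C := Set.Ici)
      (measurableSet_le measurable_fst measurable_snd) hB i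
    simp only [hIci] at h2
    -- Up to a null set, `{sel = i}` contains the event that `U i` is the strict minimum and lies in
    -- the event that it is a weak minimum. The law has no atoms, so both bounds agree, however ties
    -- are broken.
    refine le_antisymm ?_ ?_
    · rw [← h2]
      refine measure_mono_ae ?_
      filter_upwards [hmin] with ω hω
      rintro ⟨hs, hb⟩
      have hs' : sel ω = i := hs
      have hb' : (N (sel ω) ω, U (sel ω) ω) ∈ B := hb
      rw [hs'] at hb' hω
      exact ⟨hb', fun j _ => hω j⟩
    · rw [← h1]
      refine measure_mono_ae ?_
      filter_upwards [hmin] with ω hω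
      rintro ⟨hb, hlt⟩
      have hs : sel ω = i := by
        by_contra hne
        have h3 : U i ω < U (sel ω) ω := hlt _ hne
        exact absurd (hω i) (not_le.2 h3)
      refine ⟨hs, ?_⟩
      change (N (sel ω) ω, U (sel ω) ω) ∈ B
      rw [hs]; exact hb
  have hdec : {ω | (N (sel ω) ω, U (sel ω) ω) ∈ B} =
      ⋃ i, sel ⁻¹' {i} ∩ {ω | (N (sel ω) ω, U (sel ω) ω) ∈ B} := by
    ext ω; simp
  have hmB : ∀ i, MeasurableSet (sel ⁻¹' {i} ∩ {ω | (N (sel ω) ω, U (sel ω) ω) ∈ B}) := by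
    intro i
    have : sel ⁻¹' {i} ∩ {ω | (N (sel ω) ω, U (sel ω) ω) ∈ B} =
        sel ⁻¹' {i} ∩ (fun ω => (N i ω, U i ω)) ⁻¹' B := by
      ext ω
      refine and_congr_right fun (hs : sel ω = i) => ?_
      simp [hs]
    rw [this]
    exact (hsel (measurableSet_singleton i)).inter (((hN i).prodMk (hU i)) hB)
  rw [hdec, measure_iUnion (fun i j hij => Set.disjoint_left.2 fun ω h1 h2 =>
    hij (h1.1.symm.trans h2.1)) hmB, tsum_fintype, Finset.sum_congr rfl fun i _ => hi i,
    Finset.sum_const, Finset.card_univ, Fintype.card_fin, nsmul_eq_mul,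
    lintegral_const_mul' _ _ (ENNReal.natCast_ne_top L)]

end Selection

/-! ### The minimum of Erlang variables -/

/-- The tail of the Erlang distribution. -/
noncomputable def erlangTail (K : ℕ) (u : ℝ) : ℝ :=
  Real.exp (-u) * ∑ j : Fin K, u ^ (j : ℕ) / ((j : ℕ).factorial : ℝ)

/-- Differentiating the truncated exponential series drops its last term, so all but that term
cancel. The minus sign makes the derivative nonnegative on `[0, ∞)`, so that integrability on
half-lines follows from the limit at infinity. -/
theorem hasDerivAt_erlangTail (K : ℕ) (u : ℝ) :
    HasDerivAt (fun u => -erlangTail (K + 1) u) (Real.exp (-u) * (u ^ K / (K.factorial : ℝ))) u := by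
  have hpoly : HasDerivAt (fun u : ℝ => ∑ j ∈ Finset.range (K + 1), u ^ j / (j.factorial : ℝ))
      (∑ j ∈ Finset.range K, u ^ j / (j.factorial : ℝ)) u := by
    have h := HasDerivAt.fun_sum (u := Finset.range (K + 1)) (x := u)
      fun j _ => (hasDerivAt_pow j u).div_const (j.factorial : ℝ)
    refine h.congr_deriv ?_
    rw [Finset.sum_range_succ']
    simp only [Nat.cast_zero, zero_mul, zero_div, add_zero]
    refine Finset.sum_congr rfl fun j _ => ?_
    rw [Nat.factorial_succ, Nat.add_sub_cancel]
    have h1 : ((j + 1 : ℕ) : ℝ) ≠ 0 := by positivity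
    have h2 : (j.factorial : ℝ) ≠ 0 := by positivity
    push_cast at h1 ⊢
    field_simp
  have hexp : HasDerivAt (fun u : ℝ => Real.exp (-u)) (-Real.exp (-u)) u := by
    simpa using (hasDerivAt_neg u).exp
  have h := (hexp.mul hpoly).neg
  have e : (fun u => -erlangTail (K + 1) u) = -((fun u : ℝ => Real.exp (-u)) *
      fun u : ℝ => ∑ j ∈ Finset.range (K + 1), u ^ j / (j.factorial : ℝ)) := by
    ext v
    simp only [erlangTail, Pi.neg_apply, Pi.mul_apply]
    rw [Fin.sum_univ_eq_sum_range (fun j => v ^ j / (j.factorial : ℝ))]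
  rw [e]
  refine h.congr_deriv ?_
  rw [Finset.sum_range_succ]
  ring

theorem gammaMeasure_Ioi {K : ℕ} (hK : 0 < K) {u : ℝ} (hu : 0 ≤ u) :
    gammaMeasure K 1 (Set.Ioi u) = ENNReal.ofReal (erlangTail K u) := by
  obtain ⟨n, rfl⟩ : ∃ n, K = n + 1 := ⟨K - 1, by omega⟩
  have hlim : Filter.Tendsto (fun u => -erlangTail (n + 1) u) Filter.atTop (nhds 0) := by
    have : Filter.Tendsto (fun u : ℝ => ∑ j : Fin (n + 1),
        u ^ (j : ℕ) * Real.exp (-u) / ((j : ℕ).factorial : ℝ)) Filter.atTop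
        (nhds (∑ j : Fin (n + 1), 0 / ((j : ℕ).factorial : ℝ))) :=
      tendsto_finsetSum _ fun j _ =>
        (Real.tendsto_pow_mul_exp_neg_atTop_nhds_zero j).div_const _
    have h := this.neg
    simp only [zero_div, Finset.sum_const_zero, neg_zero] at h
    refine h.congr fun u => ?_
    rw [erlangTail, Finset.mul_sum]
    congr 1
    exact Finset.sum_congr rfl fun j _ => by ring
  have hnn : ∀ x ∈ Set.Ioi u, 0 ≤ Real.exp (-x) * (x ^ n / (n.factorial : ℝ)) := fun x hx => by
    have : 0 ≤ x := hu.trans (le_of_lt hx)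
    positivity
  have hint := integrableOn_Ioi_deriv_of_nonneg' (fun x _ => hasDerivAt_erlangTail n x) hnn hlim
  have hval := integral_Ioi_of_hasDerivAt_of_nonneg' (fun x _ => hasDerivAt_erlangTail n x) hnn hlim
  rw [zero_sub, neg_neg] at hval
  rw [gammaMeasure, withDensity_apply _ measurableSet_Ioi, ← hval,
    ofReal_integral_eq_lintegral_ofReal hint
      ((ae_restrict_mem measurableSet_Ioi).mono fun x hx => hnn x hx)]
  refine setLIntegral_congr_fun measurableSet_Ioi fun x hx => ?_
  have hx0 : 0 ≤ x := hu.trans (le_of_lt hx)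
  rw [gammaPDF_of_nonneg hx0]
  congr 1
  push_cast
  rw [Real.Gamma_nat_eq_factorial, Real.one_rpow, add_sub_cancel_right, Real.rpow_natCast, one_mul]
  ring

/-- The density of the smallest of `L` independent Erlang variables of shape `K`. -/
noncomputable def erlangMinPDF (L K : ℕ) (u : ℝ) : ℝ :=
  L * erlangTail K u ^ (L - 1) * (u ^ ((K : ℝ) - 1) * Real.exp (-u)) / Real.Gamma K

theorem measurable_erlangMinPDF (L K : ℕ) : Measurable (erlangMinPDF L K) := by
  unfold erlangMinPDF erlangTail; fun_prop

theorem erlangTail_nonneg (K : ℕ) {u : ℝ} (hu : 0 ≤ u) : 0 ≤ erlangTail K u :=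
  mul_nonneg (Real.exp_pos _).le (Finset.sum_nonneg fun j _ => by positivity)

theorem erlangMinPDF_nonneg (L : ℕ) {K : ℕ} (hK : 0 < K) {u : ℝ} (hu : 0 ≤ u) :
    0 ≤ erlangMinPDF L K u := by
  have h1 := erlangTail_nonneg K hu
  have h2 := Real.Gamma_pos_of_pos (Nat.cast_pos.2 hK : (0 : ℝ) < K)
  unfold erlangMinPDF
  positivity

theorem lintegral_gammaMeasure_erlangMin (L : ℕ) {K : ℕ} (hK : 0 < K) (F : ℝ → ENNReal) :
    ∫⁻ u, L * (gammaMeasure K 1 (Set.Ioi u) ^ (L - 1) * F u) ∂(gammaMeasure K 1) =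
      ∫⁻ u, F u ∂((volume.restrict (Set.Ioi 0)).withDensity
        fun u => ENNReal.ofReal (erlangMinPDF L K u)) := by
  have hm := measurable_expKernel K
  have hG := Real.Gamma_pos_of_pos (Nat.cast_pos.2 hK : (0 : ℝ) < K)
  conv_lhs => enter [1]; rw [gammaMeasure_eq_mulDensity one_pos]
  rw [mulDensity, lintegral_withDensity_eq_lintegral_mul_non_measurable _ (by fun_prop) (by simp),
    lintegral_withDensity_eq_lintegral_mul_non_measurable _
      (measurable_erlangMinPDF L K).ennreal_ofReal (by simp)]
  refine setLIntegral_congr_fun measurableSet_Ioi fun u (hu : 0 < u) => ?_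
  have h1 := erlangTail_nonneg K hu.le
  simp only [Pi.mul_apply]
  rw [gammaMeasure_Ioi hK hu.le, ← ENNReal.ofReal_pow h1, ← ENNReal.ofReal_natCast L,
    ← mul_assoc, ← mul_assoc, ← ENNReal.ofReal_mul' (by positivity),
    ← ENNReal.ofReal_mul' (by positivity)]
  congr 2
  rw [erlangMinPDF, expKernel, one_mul, Real.rpow_sub hu, Real.rpow_one]
  ring

/-! ### The laws of the channel gains and of the output -/

section Channel

variable {Ω : Type*} {L : ℕ} {m α g : Fin 2 → ℝ} {msq : ℝ} {N I : Fin L → Fin 2 → Ω → ℝ}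

/-- The gamma distributed transform of the shadowing of UAV `i`. -/
noncomputable def shadowingRoot (g : Fin 2 → ℝ) (I : Fin L → Fin 2 → Ω → ℝ) (i : Fin L) (ω : Ω) :
    ℝ :=
  2 * ((g 0 * I i 0 ω ^ (-1 : ℝ)) * (g 1 * I i 1 ω ^ (-1 : ℝ))) ^ (1 / 2 : ℝ)

theorem shadowingRoot_eq {i : Fin L} {ω : Ω} (h : ∀ j, 0 < I i j ω) :
    shadowingRoot g I i ω = 2 * (g 0 * g 1 / shadowingGain I i ω) ^ (1 / 2 : ℝ) := by
  rw [shadowingRoot, shadowingGain, Real.rpow_neg_one, Real.rpow_neg_one]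
  congr 2
  have h0 := (h 0).ne'
  have h1 := (h 1).ne'
  field_simp

theorem shadowingGain_eq {i : Fin L} {ω : Ω} (hg : ∀ j, 0 < g j) (h : ∀ j, 0 < I i j ω) :
    shadowingGain I i ω = 4 * (g 0 * g 1) / shadowingRoot g I i ω ^ 2 := by
  have hI : 0 < shadowingGain I i ω := mul_pos (h 0) (h 1)
  have hG : 0 < g 0 * g 1 := mul_pos (hg 0) (hg 1)
  rw [shadowingRoot_eq h, mul_pow, ← Real.sqrt_eq_rpow, Real.sq_sqrt (by positivity)]
  generalize g 0 * g 1 = G at hG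
  field_simp
  norm_num

variable [MeasurableSpace Ω] {μ : Measure Ω}

/-- Each gain and each root depends on its own pair of coefficients, and these pairs are disjoint.
-/
theorem IsDoubleShadowingChannel.iIndepFun_gain_root
    (hch : IsDoubleShadowingChannel μ m α g msq N I) :
    iIndepFun (Sum.elim (multipathGain N) (shadowingRoot g I)) μ := by
  classical
  have hm : ∀ k : (Fin L × Fin 2) ⊕ (Fin L × Fin 2),
      Measurable (Sum.elim (fun p : Fin L × Fin 2 => N p.1 p.2)
        (fun p : Fin L × Fin 2 => I p.1 p.2) k) := by
    rintro (p | p)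
    exacts [hch.measurable_multipath _ _, hch.measurable_shadowing _ _]
  let S : Fin L ⊕ Fin L → Finset ((Fin L × Fin 2) ⊕ (Fin L × Fin 2)) :=
    Sum.elim (fun i => {Sum.inl (i, 0), Sum.inl (i, 1)}) fun i => {Sum.inr (i, 0), Sum.inr (i, 1)}
  let h : ∀ k, (S k → ℝ) → ℝ := fun k => match k with
    | Sum.inl i => fun v =>
      (v ⟨Sum.inl (i, 0), by simp [S]⟩ * v ⟨Sum.inl (i, 1), by simp [S]⟩) ^ 2
    | Sum.inr i => fun v =>
      2 * ((g 0 * v ⟨Sum.inr (i, 0), by simp [S]⟩ ^ (-1 : ℝ)) *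
        (g 1 * v ⟨Sum.inr (i, 1), by simp [S]⟩ ^ (-1 : ℝ))) ^ (1 / 2 : ℝ)
  have key := iIndepFun_comp_blocks hch.indep hm S ?_ h ?_
  · convert key using 1
    ext k ω
    rcases k with i | i <;> rfl
  · rintro (i | i) (j | j) hij <;> simp [S] at hij ⊢ <;> tauto
  · rintro (i | i)
    · change Measurable fun v : S (Sum.inl i) → ℝ =>
        (v ⟨Sum.inl (i, 0), by simp [S]⟩ * v ⟨Sum.inl (i, 1), by simp [S]⟩) ^ 2
      fun_prop
    · change Measurable fun v : S (Sum.inr i) → ℝ =>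
        2 * ((g 0 * v ⟨Sum.inr (i, 0), by simp [S]⟩ ^ (-1 : ℝ)) *
        (g 1 * v ⟨Sum.inr (i, 1), by simp [S]⟩ ^ (-1 : ℝ))) ^ (1 / 2 : ℝ)
      fun_prop

theorem IsDoubleShadowingChannel.map_multipathGain [IsProbabilityMeasure μ]
    (hch : IsDoubleShadowingChannel μ m α g msq N I) (hm : ∀ j, 0 < m j) (hmsq : 0 < msq)
    (i : Fin L) : μ.map (multipathGain N i) = mulDensity fun x =>
      prodKernel (m 0) (m 1) (m 0 / msq * (m 1 / msq) * x) /
        (Real.Gamma (m 0) * Real.Gamma (m 1)) := by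
  have hind : IndepFun (N i 0) (N i 1) μ :=
    hch.indep.indepFun (i := Sum.inl (i, 0)) (j := Sum.inl (i, 1)) (by simp)
  have h := map_mul_of_hasLaw_gamma (hind.comp (φ := fun x : ℝ => x ^ 2) (ψ := fun x : ℝ => x ^ 2)
    (by fun_prop) (by fun_prop)) (hm 0) (hm 1) (div_pos (hm 0) hmsq) (div_pos (hm 1) hmsq)
    (hch.law_multipath i 0) (hch.law_multipath i 1)
  rw [← h]
  congr 1
  ext ω
  simp [multipathGain, mul_pow]

theorem IsDoubleShadowingChannel.map_shadowingRoot [IsProbabilityMeasure μ]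
    (hch : IsDoubleShadowingChannel μ m α g msq N I) (hα : 0 < α 0) (hg : ∀ j, 0 < g j)
    (hα₂ : α 1 = α 0 + 1 / 2) (i : Fin L) :
    μ.map (shadowingRoot g I i) = gammaMeasure (2 * α 0) 1 := by
  have hind : IndepFun (I i 0) (I i 1) μ :=
    hch.indep.indepFun (i := Sum.inr (i, 0)) (j := Sum.inr (i, 1)) (by simp)
  exact (hasLaw_sqrt_of_invGamma hind hα (hg 0) (hg 1) (hch.law_shadowing i 0)
    (hα₂ ▸ hch.law_shadowing i 1)).map_eq

theorem IsDoubleShadowingChannel.ae_shadowing_pos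
    (hch : IsDoubleShadowingChannel μ m α g msq N I) (hg : ∀ j, 0 < g j) :
    ∀ᵐ ω ∂μ, ∀ i j, 0 < I i j ω := by
  rw [ae_all_iff]; intro i
  rw [ae_all_iff]; intro j
  refine ae_of_ae_map (hch.law_shadowing i j).aemeasurable ?_
  rw [(hch.law_shadowing i j).map_eq, invGammaMeasure_eq_mulDensity (hg j)]
  exact ae_pos_mulDensity _

/-- The law of the output SNR as a mixture. -/
theorem IsDoubleShadowingChannel.map_outputSNR {K : ℕ} [IsProbabilityMeasure μ]
    (hch : IsDoubleShadowingChannel μ m α g msq N I) (hm : ∀ j, 0 < m j) (hα : 0 < α 0)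
    (hg : ∀ j, 0 < g j) (hmsq : 0 < msq) (hK : 2 * α 0 = (K : ℝ)) (hα₂ : α 1 = α 0 + 1 / 2)
    {sel : Ω → Fin L} (hsel : IsShadowingSelection I sel) {H : ℝ → ℝ}
    (hH : ∀ x, 0 < x →
      IntegrableOn (fun u => erlangMinPDF L K u * (prodKernel (m 0) (m 1)
        (snrScale m g msq * x * (u ^ 2 / 4)) / (Real.Gamma (m 0) * Real.Gamma (m 1))))
        (Set.Ioi 0) ∧
      ∫ u in Set.Ioi 0, erlangMinPDF L K u * (prodKernel (m 0) (m 1)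
        (snrScale m g msq * x * (u ^ 2 / 4)) / (Real.Gamma (m 0) * Real.Gamma (m 1))) = H x) :
    AEMeasurable (outputSNR N I sel) μ ∧ μ.map (outputSNR N I sel) = mulDensity H := by
  have hK0 : 0 < K := by
    have : (0 : ℝ) < K := by rw [← hK]; linarith
    exact_mod_cast this
  have hG : 0 < g 0 * g 1 := mul_pos (hg 0) (hg 1)
  have hmm : 0 < Real.Gamma (m 0) * Real.Gamma (m 1) :=
    mul_pos (Real.Gamma_pos_of_pos (hm 0)) (Real.Gamma_pos_of_pos (hm 1))
  have hN : ∀ i, Measurable (multipathGain N i) := fun i => by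
    have := hch.measurable_multipath i 0
    have := hch.measurable_multipath i 1
    unfold multipathGain; fun_prop
  have hU : ∀ i, Measurable (shadowingRoot g I i) := fun i => by
    have := hch.measurable_shadowing i 0
    have := hch.measurable_shadowing i 1
    unfold shadowingRoot; fun_prop
  have hlU : ∀ i, μ.map (shadowingRoot g I i) = gammaMeasure K 1 := fun i => by
    rw [hch.map_shadowingRoot hα hg hα₂ i, hK]
  have hatom : ∀ u, gammaMeasure K 1 {u} = 0 := fun u => by
    rw [gammaMeasure_eq_mulDensity one_pos]; exact mulDensity_singleton _ u
  have hpos := hch.ae_shadowing_pos hg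
  -- The root decreases in the gain, so selecting the largest gain selects the smallest root.
  have hmin : ∀ᵐ ω ∂μ, ∀ j, shadowingRoot g I (sel ω) ω ≤ shadowingRoot g I j ω := by
    filter_upwards [hpos] with ω hω j
    rw [shadowingRoot_eq (hω _), shadowingRoot_eq (hω _)]
    have h1 : 0 < shadowingGain I j ω := mul_pos (hω j 0) (hω j 1)
    have h2 := hsel.2 ω j
    have h3 : 0 < shadowingGain I (sel ω) ω := h1.trans_le h2
    gcongr
  have hsup : ∀ ω, ⨆ i, shadowingGain I i ω = shadowingGain I (sel ω) ω := fun ω => by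
    have : Nonempty (Fin L) := ⟨sel ω⟩
    exact le_antisymm (ciSup_le (hsel.2 ω))
      (le_ciSup (f := fun i => shadowingGain I i ω) (Set.finite_range _).bddAbove (sel ω))
  have hout : outputSNR N I sel =ᵐ[μ] fun ω => 4 * (g 0 * g 1) / shadowingRoot g I (sel ω) ω ^ 2 *
      multipathGain N (sel ω) ω := by
    filter_upwards [hpos] with ω hω
    rw [outputSNR, hsup, shadowingGain_eq hg (hω _), mul_comm]
  have hsm : ∀ {f : Fin L → Ω → ℝ}, (∀ i, Measurable (f i)) → Measurable fun ω => f (sel ω) ω :=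
    fun {f} hf => (measurable_from_prod_countable_right hf :
      Measurable fun p : Fin L × Ω => f p.1 p.2).comp (hsel.1.prodMk measurable_id)
  have hmout : Measurable fun ω => 4 * (g 0 * g 1) / shadowingRoot g I (sel ω) ω ^ 2 *
      multipathGain N (sel ω) ω := ((hsm hU).pow_const 2 |>.const_div _).mul (hsm hN)
  refine ⟨hmout.aemeasurable.congr hout.symm, ?_⟩
  have hp : Measurable fun u : ℝ => 4 * (g 0 * g 1) / u ^ 2 := by fun_prop
  rw [Measure.map_congr hout]
  ext B hB
  rw [Measure.map_apply hmout hB]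
  have hB2 : MeasurableSet {p : ℝ × ℝ | 4 * (g 0 * g 1) / p.2 ^ 2 * p.1 ∈ B} :=
    (by fun_prop : Measurable fun p : ℝ × ℝ => 4 * (g 0 * g 1) / p.2 ^ 2 * p.1) hB
  have h1 := measure_selected hch.iIndepFun_gain_root hN hU
    (hch.map_multipathGain hm hmsq) hlU hatom hsel.1 hmin hB2
  have hkm : Measurable fun x => prodKernel (m 0) (m 1) (m 0 / msq * (m 1 / msq) * x) /
      (Real.Gamma (m 0) * Real.Gamma (m 1)) :=
    ((measurable_prodKernel _ _).comp (by fun_prop)).div_const _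
  refine h1.trans ?_
  rw [lintegral_gammaMeasure_erlangMin L hK0]
  simp only [Set.mem_ofPred_eq]
  rw [lintegral_mulDensity_preimage hkm hp ?_ hB, mulDensity]
  · congr 1
    refine withDensity_congr_ae ?_
    filter_upwards [ae_restrict_mem measurableSet_Ioi] with x (hx : 0 < x)
    rw [ENNReal.ofReal_mul (inv_nonneg.2 hx.le),
      lintegral_withDensity_eq_lintegral_mul_non_measurable _
      (measurable_erlangMinPDF L K).ennreal_ofReal (by simp), ← (hH x hx).2,
      ofReal_integral_eq_lintegral_ofReal (hH x hx).1]
    · congr 1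
      refine setLIntegral_congr_fun measurableSet_Ioi fun u (hu : 0 < u) => ?_
      simp only [Pi.mul_apply]
      rw [← ENNReal.ofReal_mul (erlangMinPDF_nonneg L hK0 hu.le)]
      congr 4
      -- The rates `m j / msq` of the gain and the dilation by `4 g₁ g₂ / u²` combine to `γ̃ u² /
      -- 4`.
      rw [snrScale]
      have := hg 0
      have := hg 1
      field_simp
    · filter_upwards [ae_restrict_mem measurableSet_Ioi] with u (hu : 0 < u)
      have hs : 0 < snrScale m g msq := by
        have := hm 0
        have := hm 1
        unfold snrScale; positivity
      exact mul_nonneg (erlangMinPDF_nonneg L hK0 hu.le)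
        (div_nonneg (prodKernel_nonneg _ _ (by positivity)) hmm.le)
  · refine (withDensity_absolutelyContinuous _ _).ae_le ?_
    filter_upwards [ae_restrict_mem measurableSet_Ioi] with u (hu : 0 < u)
    positivity

end Channel

/-! ### Expansion of the density of the minimum -/

/-- Expand `((Q - 1) + 1)^M`, then each `(Q - 1)^i₁`. This redundant form reproduces the double sum
of the closed formulas. -/
theorem pow_eq_sum_choose_choose (Q : ℝ) (M : ℕ) :
    Q ^ M = ∑ i₁ ∈ Finset.range (M + 1), ∑ i₂ ∈ Finset.range (i₁ + 1),
      (M.choose i₁ : ℝ) * (i₁.choose i₂ : ℝ) * ((-1) ^ (i₁ + i₂) * Q ^ i₂) := by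
  have h : Q = (Q + -1) + 1 := by ring
  conv_lhs => rw [h, add_pow]
  refine Finset.sum_congr rfl fun i₁ _ => ?_
  rw [one_pow, mul_one, add_pow, Finset.sum_mul]
  refine Finset.sum_congr rfl fun i₂ hi => ?_
  have hle : i₂ ≤ i₁ := Nat.lt_succ_iff.1 (Finset.mem_range.1 hi)
  have : (-1 : ℝ) ^ (i₁ + i₂) = (-1) ^ (i₁ - i₂) := by
    rw [show i₁ + i₂ = (i₁ - i₂) + 2 * i₂ by omega, pow_add, pow_mul]; simp
  rw [this]; ring

theorem erlangTail_pow (K i : ℕ) (u : ℝ) :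
    erlangTail K u ^ i = ∑ n ∈ Finset.piAntidiag (Finset.univ : Finset (Fin K)) i,
      (i.factorial : ℝ) / (∏ j : Fin K, ((n j).factorial : ℝ)) *
        (∏ j : Fin K, (1 / ((j : ℕ).factorial : ℝ)) ^ n j) *
        (u ^ (∑ j : Fin K, (j : ℕ) * n j) * Real.exp (-(i * u))) := by
  rw [erlangTail, mul_pow, Finset.sum_pow_eq_sum_piAntidiag, Finset.mul_sum]
  refine Finset.sum_congr rfl fun n hn => ?_
  have hsum : ∑ j, n j = i := (Finset.mem_piAntidiag.1 hn).1
  have h1 : (Nat.multinomial Finset.univ n : ℝ) =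
      (i.factorial : ℝ) / (∏ j : Fin K, ((n j).factorial : ℝ)) := by
    have h := Nat.multinomial_spec Finset.univ n
    rw [hsum] at h
    have h0 : (∏ j : Fin K, ((n j).factorial : ℝ)) ≠ 0 :=
      Finset.prod_ne_zero_iff.2 fun j _ => by positivity
    rw [eq_div_iff h0, ← h]
    push_cast; ring
  have h2 : ∏ j : Fin K, (u ^ (j : ℕ) / ((j : ℕ).factorial : ℝ)) ^ n j =
      (∏ j : Fin K, (1 / ((j : ℕ).factorial : ℝ)) ^ n j) * u ^ (∑ j : Fin K, (j : ℕ) * n j) := by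
    rw [← Finset.prod_pow_eq_pow_sum, ← Finset.prod_mul_distrib]
    refine Finset.prod_congr rfl fun j _ => ?_
    rw [pow_mul, ← mul_pow]; ring
  rw [h1, h2, ← Real.exp_nat_mul]
  ring_nf

/-- The coefficient of `gammaAverage` in the expansion of the output PDF. -/
noncomputable def snrAverageCoeff (L : ℕ) (m α : Fin 2 → ℝ) {K : ℕ} (i₁ i₂ : ℕ) (n : Fin K → ℕ) :
    ℝ :=
  snrWeight L m α i₁ i₂ n * (√Real.pi * ((i₂ : ℝ) + 1) ^ (snrExponent α n - 1 / 2) /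
    2 ^ (snrExponent α n - 1 / 2 - 1))

theorem snrExponent_sub_half {K : ℕ} {α : Fin 2 → ℝ} (hK : 2 * α 0 = (K : ℝ))
    (hα₂ : α 1 = α 0 + 1 / 2) (n : Fin K → ℕ) :
    snrExponent α n - 1 / 2 = K + ((∑ j : Fin K, (j : ℕ) * n j : ℕ) : ℝ) := by
  rw [snrExponent, hα₂, ← hK]; push_cast; ring

/-- The powers of `i₂ + 1` cancel outright. Duplication turns `Γ(α₁) Γ(α₂)` into `Γ(K) 2^(1 - K)
√π`, and the powers of `2` from the factors `(2^j / j!)^{n_j}` cancel the rest of `2^(q - 3/2)`. -/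
theorem snrAverageCoeff_eq (L : ℕ) {K : ℕ} {m α : Fin 2 → ℝ} (hα : 0 < α 0)
    (hK : 2 * α 0 = (K : ℝ)) (hα₂ : α 1 = α 0 + 1 / 2) (i₁ i₂ : ℕ) (n : Fin K → ℕ) :
    snrAverageCoeff L m α i₁ i₂ n =
      L / (Real.Gamma K * (Real.Gamma (m 0) * Real.Gamma (m 1))) * ((-1) ^ (i₁ + i₂) *
      ((i₂.factorial : ℝ) / (∏ j : Fin K, ((n j).factorial : ℝ)) *
        (∏ j : Fin K, (1 / ((j : ℕ).factorial : ℝ)) ^ n j))) := by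
  have hd : Real.Gamma (α 0) * Real.Gamma (α 1) =
      Real.Gamma K * 2 ^ (1 - (K : ℝ)) * √Real.pi := by
    rw [hα₂, Real.Gamma_mul_Gamma_add_half, hK]
  have hprod : ∏ j : Fin K, ((2 : ℝ) ^ (j : ℕ) / ((j : ℕ).factorial : ℝ)) ^ n j =
      2 ^ (∑ j : Fin K, (j : ℕ) * n j) *
        ∏ j : Fin K, (1 / ((j : ℕ).factorial : ℝ)) ^ n j := by
    rw [← Finset.prod_pow_eq_pow_sum, ← Finset.prod_mul_distrib]
    refine Finset.prod_congr rfl fun j _ => ?_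
    rw [pow_mul, ← mul_pow]; ring
  have hKpos : (0 : ℝ) < K := by rw [← hK]; linarith
  have hG := (Real.Gamma_pos_of_pos hKpos).ne'
  have hpi := (Real.sqrt_pos.2 Real.pi_pos).ne'
  have h2 : (2 : ℝ) ^ (1 - (K : ℝ)) ≠ 0 := (Real.rpow_pos_of_pos two_pos _).ne'
  have hl : ((i₂ : ℝ) + 1) ^ (K + ((∑ j : Fin K, (j : ℕ) * n j : ℕ) : ℝ)) ≠ 0 :=
    (Real.rpow_pos_of_pos (by positivity) _).ne'
  have hpow : (2 : ℝ) ^ (K + ((∑ j : Fin K, (j : ℕ) * n j : ℕ) : ℝ) - 1) =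
      2 ^ (∑ j : Fin K, (j : ℕ) * n j) * (2 ^ (1 - (K : ℝ)))⁻¹ := by
    rw [← Real.rpow_natCast, ← Real.rpow_neg two_pos.le, ← Real.rpow_add two_pos]
    ring_nf
  have hS : snrConst m α =
      1 / (Real.Gamma (m 0) * Real.Gamma (m 1) * (Real.Gamma K * 2 ^ (1 - (K : ℝ)) * √Real.pi)) := by
    rw [snrConst, ← hd]; ring
  have h2J : (2 : ℝ) ^ (∑ j : Fin K, (j : ℕ) * n j) ≠ 0 := by positivity
  rw [snrAverageCoeff, snrWeight, snrCoeff, snrExponent_sub_half hK hα₂, hprod, hS, hpow]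
  generalize (∏ j : Fin K, (1 / ((j : ℕ).factorial : ℝ)) ^ n j) = A
  generalize (∏ j : Fin K, ((n j).factorial : ℝ)) = D
  generalize (2 : ℝ) ^ (∑ j : Fin K, (j : ℕ) * n j) = E at h2J ⊢
  generalize Real.Gamma (m 0) * Real.Gamma (m 1) = M
  generalize (2 : ℝ) ^ (1 - (K : ℝ)) = F at h2 ⊢
  generalize ((i₂ : ℝ) + 1) ^ (K + ((∑ j : Fin K, (j : ℕ) * n j : ℕ) : ℝ)) = P at hl ⊢
  field_simp

/-- A sum over the index set of the closed forms. -/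
noncomputable def snrSum {R : Type*} [CommRing R] (L K : ℕ) (T : ℕ → ℕ → (Fin K → ℕ) → R) : R :=
  ∑ i₁ ∈ Finset.range L, ∑ i₂ ∈ Finset.range (i₁ + 1),
    ((L - 1).choose i₁ : R) * (i₁.choose i₂ : R) *
      ∑ n ∈ Finset.piAntidiag (Finset.univ : Finset (Fin K)) i₂, T i₁ i₂ n

theorem ofReal_snrSum (L K : ℕ) (T : ℕ → ℕ → (Fin K → ℕ) → ℝ) :
    ((snrSum L K T : ℝ) : ℂ) = snrSum L K fun i₁ i₂ n => ((T i₁ i₂ n : ℝ) : ℂ) := by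
  simp [snrSum]

theorem mul_snrSum {R : Type*} [CommRing R] (L K : ℕ) (T : ℕ → ℕ → (Fin K → ℕ) → R) (c : R) :
    c * snrSum L K T = snrSum L K fun i₁ i₂ n => c * T i₁ i₂ n := by
  simp only [snrSum, Finset.mul_sum]
  refine Finset.sum_congr rfl fun _ _ => Finset.sum_congr rfl fun _ _ =>
    Finset.sum_congr rfl fun _ _ => by ring

theorem integral_snrSum {X : Type*} [MeasurableSpace X] {ν : Measure X} (L K : ℕ)
    {T : X → ℕ → ℕ → (Fin K → ℕ) → ℝ} (hT : ∀ i₁ i₂ n, Integrable (fun x => T x i₁ i₂ n) ν) :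
    Integrable (fun x => snrSum L K (T x)) ν ∧
      ∫ x, snrSum L K (T x) ∂ν = snrSum L K fun i₁ i₂ n => ∫ x, T x i₁ i₂ n ∂ν := by
  have h1 : ∀ i₁ i₂, Integrable (fun x => ∑ n ∈ Finset.piAntidiag (Finset.univ : Finset (Fin K)) i₂,
      T x i₁ i₂ n) ν := fun i₁ i₂ => integrable_finsetSum _ fun n _ => hT i₁ i₂ n
  have h2 : ∀ i₁, Integrable (fun x => ∑ i₂ ∈ Finset.range (i₁ + 1),
      ((L - 1).choose i₁ : ℝ) * (i₁.choose i₂ : ℝ) *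
      ∑ n ∈ Finset.piAntidiag (Finset.univ : Finset (Fin K)) i₂, T x i₁ i₂ n) ν :=
    fun i₁ => integrable_finsetSum _ fun i₂ _ => (h1 i₁ i₂).const_mul _
  refine ⟨integrable_finsetSum _ fun i₁ _ => h2 i₁, ?_⟩
  simp only [snrSum]
  rw [integral_finsetSum _ fun i₁ _ => h2 i₁]
  refine Finset.sum_congr rfl fun i₁ _ => ?_
  rw [integral_finsetSum _ fun i₂ _ => (h1 i₁ i₂).const_mul _]
  refine Finset.sum_congr rfl fun i₂ _ => ?_
  rw [integral_const_mul, integral_finsetSum _ fun n _ => hT i₁ i₂ n]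

theorem erlangMinPDF_div_eq_snrSum {L K : ℕ} (hL : 1 ≤ L) {m α : Fin 2 → ℝ} (hα : 0 < α 0)
    (hK : 2 * α 0 = (K : ℝ)) (hα₂ : α 1 = α 0 + 1 / 2) {u : ℝ} (hu : 0 < u) :
    erlangMinPDF L K u / (Real.Gamma (m 0) * Real.Gamma (m 1)) =
      snrSum L K fun i₁ i₂ n => snrAverageCoeff L m α i₁ i₂ n *
        (u ^ (snrExponent α n - 1 / 2 - 1) * Real.exp (-(((i₂ : ℝ) + 1) * u))) := by
  have e : erlangMinPDF L K u / (Real.Gamma (m 0) * Real.Gamma (m 1)) =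
      (L / (Real.Gamma K * (Real.Gamma (m 0) * Real.Gamma (m 1))) *
        (u ^ ((K : ℝ) - 1) * Real.exp (-u))) * erlangTail K u ^ (L - 1) := by
    rw [erlangMinPDF, div_div]; ring
  have e2 : erlangTail K u ^ (L - 1) = snrSum L K fun i₁ i₂ n => (-1) ^ (i₁ + i₂) *
      ((i₂.factorial : ℝ) / (∏ j : Fin K, ((n j).factorial : ℝ)) *
        (∏ j : Fin K, (1 / ((j : ℕ).factorial : ℝ)) ^ n j) *
        (u ^ (∑ j : Fin K, (j : ℕ) * n j) * Real.exp (-(i₂ * u)))) := by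
    rw [pow_eq_sum_choose_choose, Nat.sub_add_cancel hL, snrSum]
    refine Finset.sum_congr rfl fun i₁ _ => Finset.sum_congr rfl fun i₂ _ => ?_
    rw [erlangTail_pow, Finset.mul_sum]
  rw [e, e2, mul_snrSum]
  congr 1
  ext i₁ i₂ n
  rw [snrAverageCoeff_eq L hα hK hα₂, snrExponent_sub_half hK hα₂, add_sub_right_comm,
    Real.rpow_add hu, Real.rpow_natCast, add_mul, one_mul, neg_add, Real.exp_add]
  ring

theorem snrExponent_sub_half_pos {K : ℕ} {α : Fin 2 → ℝ} (hα : 0 < α 0) (hK : 2 * α 0 = (K : ℝ))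
    (hα₂ : α 1 = α 0 + 1 / 2) (n : Fin K → ℕ) : 0 < snrExponent α n - 1 / 2 := by
  rw [snrExponent_sub_half hK hα₂, ← hK]; positivity

/-- `x` times the output PDF at `x`, as a combination of averages. -/
noncomputable def outputKernel (L K : ℕ) (m α g : Fin 2 → ℝ) (msq x : ℝ) : ℝ :=
  snrSum L K fun i₁ i₂ n => snrAverageCoeff L m α i₁ i₂ n *
    gammaAverage (m 0) (m 1) (snrExponent α n - 1 / 2) ((i₂ : ℝ) + 1) (snrScale m g msq * x)

theorem measurable_outputKernel (L K : ℕ) (m α g : Fin 2 → ℝ) (msq : ℝ) :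
    Measurable (outputKernel L K m α g msq) := by
  unfold outputKernel snrSum
  refine Finset.measurable_fun_sum _ fun i₁ _ => Finset.measurable_fun_sum _ fun i₂ _ =>
    (Finset.measurable_fun_sum _ fun n _ => ?_).const_mul _
  exact ((measurable_gammaAverage _ _ _ _).comp (measurable_const_mul _)).const_mul _

theorem integral_erlangMinPDF_mul_prodKernel {L K : ℕ} (hL : 1 ≤ L) {m α g : Fin 2 → ℝ} {msq : ℝ}
    (hm : ∀ j, 0 < m j) (hα : 0 < α 0) (hs : 0 < snrScale m g msq)
    (hK : 2 * α 0 = (K : ℝ)) (hα₂ : α 1 = α 0 + 1 / 2) {x : ℝ} (hx : 0 < x) :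
    IntegrableOn (fun u => erlangMinPDF L K u * (prodKernel (m 0) (m 1)
      (snrScale m g msq * x * (u ^ 2 / 4)) / (Real.Gamma (m 0) * Real.Gamma (m 1))))
      (Set.Ioi 0) ∧
    ∫ u in Set.Ioi 0, erlangMinPDF L K u * (prodKernel (m 0) (m 1)
      (snrScale m g msq * x * (u ^ 2 / 4)) / (Real.Gamma (m 0) * Real.Gamma (m 1))) =
      outputKernel L K m α g msq x := by
  have hT : ∀ (i₁ i₂ : ℕ) (n : Fin K → ℕ), Integrable (fun u => snrAverageCoeff L m α i₁ i₂ n *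
      (u ^ (snrExponent α n - 1 / 2 - 1) * Real.exp (-(((i₂ : ℝ) + 1) * u)) *
        prodKernel (m 0) (m 1) (snrScale m g msq * x * (u ^ 2 / 4))))
      (volume.restrict (Set.Ioi 0)) := fun i₁ i₂ n =>
    -- The line `Re s = 0` is admissible because `m j` and `q - 1/2` are positive.
    ((gammaAverage_average (c := 0) (hm 0) (hm 1)
      (by simpa using snrExponent_sub_half_pos hα hK hα₂ n) (by positivity)).1 _
      (mul_pos hs hx)).const_mul _
  obtain ⟨h1, h2⟩ := integral_snrSum L K hT
  have heq : ∀ u ∈ Set.Ioi (0 : ℝ), (snrSum L K fun i₁ i₂ n => snrAverageCoeff L m α i₁ i₂ n *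
      (u ^ (snrExponent α n - 1 / 2 - 1) * Real.exp (-(((i₂ : ℝ) + 1) * u)) *
        prodKernel (m 0) (m 1) (snrScale m g msq * x * (u ^ 2 / 4)))) =
      erlangMinPDF L K u * (prodKernel (m 0) (m 1)
      (snrScale m g msq * x * (u ^ 2 / 4)) / (Real.Gamma (m 0) * Real.Gamma (m 1))) := by
    intro u hu
    rw [← mul_div_assoc (erlangMinPDF L K u), mul_div_right_comm (erlangMinPDF L K u),
      erlangMinPDF_div_eq_snrSum hL hα hK hα₂ hu,
      mul_comm (snrSum _ _ _), mul_snrSum]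
    congr 1
    ext i₁ i₂ n
    ring
  refine ⟨IntegrableOn.congr_fun h1 heq measurableSet_Ioi, ?_⟩
  rw [← setIntegral_congr_fun measurableSet_Ioi heq, h2, outputKernel]
  simp only [integral_const_mul, gammaAverage]

theorem ofReal_snrAverageCoeff_mul (L : ℕ) {K : ℕ} (m α : Fin 2 → ℝ) (i₁ i₂ : ℕ) (n : Fin K → ℕ)
    (M : ℂ) : ((snrAverageCoeff L m α i₁ i₂ n : ℝ) : ℂ) *
      (((2 ^ (snrExponent α n - 1 / 2 - 1) /
        (√Real.pi * ((i₂ : ℝ) + 1) ^ (snrExponent α n - 1 / 2)) : ℝ) : ℂ) * M) =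
      (snrWeight L m α i₁ i₂ n : ℂ) * M := by
  rw [← mul_assoc, ← Complex.ofReal_mul, snrAverageCoeff]
  congr 2
  have h1 : ((i₂ : ℝ) + 1) ^ (snrExponent α n - 1 / 2) ≠ 0 :=
    (Real.rpow_pos_of_pos (by positivity) _).ne'
  have h2 : (2 : ℝ) ^ (snrExponent α n - 1 / 2 - 1) ≠ 0 := (Real.rpow_pos_of_pos two_pos _).ne'
  have hpi := (Real.sqrt_pos.2 Real.pi_pos).ne'
  field_simp

/-! ### The closed forms and the theorem -/

theorem outputPDFFormula_eq {L K : ℕ} {m α g : Fin 2 → ℝ} {msq : ℝ}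
    (hm : ∀ j, 0 < m j) (hα : 0 < α 0) (hs : 0 < snrScale m g msq)
    (hK : 2 * α 0 = (K : ℝ)) (hα₂ : α 1 = α 0 + 1 / 2) {x : ℝ} (hx : 0 < x) :
    ((x⁻¹ * outputKernel L K m α g msq x : ℝ) : ℂ) = outputPDFFormula L K m α g msq x := by
  rw [Complex.ofReal_mul, outputKernel, ofReal_snrSum, mul_snrSum, outputPDFFormula, snrSum]
  refine Finset.sum_congr rfl fun i₁ _ => Finset.sum_congr rfl fun i₂ _ => ?_
  congr 1
  refine Finset.sum_congr rfl fun n _ => ?_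
  rw [Complex.ofReal_mul, gammaAverage_eq_meijerG (hm 0) (hm 1)
    (snrExponent_sub_half_pos hα hK hα₂ n) (by positivity) (mul_pos hs hx), sub_add_cancel,
    ofReal_snrAverageCoeff_mul, Complex.ofReal_inv, mul_assoc]

theorem outputCDFFormula_eq {L K : ℕ} {m α g : Fin 2 → ℝ} {msq : ℝ}
    (hm : ∀ j, 0 < m j) (hα : 0 < α 0) (hs : 0 < snrScale m g msq)
    (hK : 2 * α 0 = (K : ℝ)) (hα₂ : α 1 = α 0 + 1 / 2) {x : ℝ} (hx : 0 < x) :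
    IntegrableOn (fun t => t⁻¹ * outputKernel L K m α g msq t) (Set.Ioc 0 x) ∧
    ((∫ t in Set.Ioc 0 x, t⁻¹ * outputKernel L K m α g msq t : ℝ) : ℂ) =
      outputCDFFormula L K m α g msq x := by
  have hterm := fun (i₂ : ℕ) (n : Fin K → ℕ) => integral_gammaAverage_eq_meijerG (hm 0) (hm 1)
    (snrExponent_sub_half_pos hα hK hα₂ n) (show 0 < (i₂ : ℝ) + 1 by positivity) hs hx
  have hT : ∀ (i₁ i₂ : ℕ) (n : Fin K → ℕ), Integrable (fun t => snrAverageCoeff L m α i₁ i₂ n *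
      (t⁻¹ * gammaAverage (m 0) (m 1) (snrExponent α n - 1 / 2) ((i₂ : ℝ) + 1)
        (snrScale m g msq * t))) (volume.restrict (Set.Ioc 0 x)) :=
    fun i₁ i₂ n => (hterm i₂ n).1.const_mul _
  obtain ⟨h1, h2⟩ := integral_snrSum L K hT
  have heq : ∀ t, (snrSum L K fun i₁ i₂ n => snrAverageCoeff L m α i₁ i₂ n *
      (t⁻¹ * gammaAverage (m 0) (m 1) (snrExponent α n - 1 / 2) ((i₂ : ℝ) + 1)
        (snrScale m g msq * t))) = t⁻¹ * outputKernel L K m α g msq t := fun t => by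
    rw [outputKernel, mul_snrSum]
    congr 1
    ext i₁ i₂ n
    ring
  simp only [heq] at h1 h2
  refine ⟨h1, ?_⟩
  rw [h2, ofReal_snrSum, outputCDFFormula, snrSum]
  refine Finset.sum_congr rfl fun i₁ _ => Finset.sum_congr rfl fun i₂ _ => ?_
  congr 1
  refine Finset.sum_congr rfl fun n _ => ?_
  rw [integral_const_mul, Complex.ofReal_mul, (hterm i₂ n).2, sub_add_cancel,
    ofReal_snrAverageCoeff_mul]

theorem mainTheorem7 {Ω : Type*} [MeasurableSpace Ω] (μ : Measure Ω) [IsProbabilityMeasure μ]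
    (L K : ℕ) (hL : 1 ≤ L)
    (m α g : Fin 2 → ℝ) (msq : ℝ)
    (hm : ∀ j, 0 < m j) (hα : ∀ j, 1 < α j) (hg : ∀ j, 0 < g j) (hmsq : 0 < msq)
    (hK : 2 * α 0 = (K : ℝ)) (hα₂ : α 1 = α 0 + 1 / 2)
    (N I : Fin L → Fin 2 → Ω → ℝ) (hch : IsDoubleShadowingChannel μ m α g msq N I)
    (sel : Ω → Fin L) (hsel : IsShadowingSelection I sel) :
    (∃ f : ℝ → ℝ,
        Measurable f ∧ (∀ x, 0 ≤ f x) ∧ (∀ x ≤ 0, f x = 0) ∧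
        (∀ x, 0 < x → (f x : ℂ) = outputPDFFormula L K m α g msq x) ∧
        HasLaw (outputSNR N I sel) (volume.withDensity fun x => ENNReal.ofReal (f x)) μ) ∧
    (∀ x, x ≤ 0 → cdf (μ.map (outputSNR N I sel)) x = 0) ∧
    (∀ x, 0 < x →
        ((cdf (μ.map (outputSNR N I sel)) x : ℝ) : ℂ) = outputCDFFormula L K m α g msq x) := by
  have hα0 : 0 < α 0 := one_pos.trans (hα 0)
  have hK0 : 0 < K := by
    have : (0 : ℝ) < K := by rw [← hK]; linarith
    exact_mod_cast this
  have hs : 0 < snrScale m g msq := by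
    have := hm 0
    have := hm 1
    have := hg 0
    have := hg 1
    unfold snrScale; positivity
  set H := outputKernel L K m α g msq with hHdef
  have hint := fun x (hx : 0 < x) =>
    integral_erlangMinPDF_mul_prodKernel (g := g) (msq := msq) hL hm hα0 hs hK hα₂ hx
  obtain ⟨hmeas, hlaw⟩ := hch.map_outputSNR hm hα0 hg hmsq hK hα₂ hsel hint
  -- The closed form has alternating signs; nonnegativity is read off from the mixture integral
  -- instead.
  have hH0 : ∀ x, 0 < x → 0 ≤ H x := fun x hx => by
    rw [hHdef, ← (hint x hx).2]
    refine setIntegral_nonneg measurableSet_Ioi fun u (hu : 0 < u) => ?_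
    exact mul_nonneg (erlangMinPDF_nonneg L hK0 hu.le) (div_nonneg
      (prodKernel_nonneg _ _ (by positivity))
      (mul_pos (Real.Gamma_pos_of_pos (hm 0)) (Real.Gamma_pos_of_pos (hm 1))).le)
  have : IsProbabilityMeasure (μ.map (outputSNR N I sel)) := Measure.isProbabilityMeasure_map hmeas
  refine ⟨⟨fun x => if 0 < x then x⁻¹ * H x else 0, ?_, fun x => ?_, fun x hx => ?_,
    fun x hx => ?_, ⟨hmeas, ?_⟩⟩, fun x hx => ?_, fun x hx => ?_⟩
  · exact Measurable.ite measurableSet_Ioi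
      (measurable_inv.mul (measurable_outputKernel L K m α g msq)) measurable_const
  · dsimp only
    split_ifs with h
    · exact mul_nonneg (inv_nonneg.2 h.le) (hH0 x h)
    · exact le_rfl
  · exact if_neg (not_lt.2 hx)
  · simp only [if_pos hx]
    exact outputPDFFormula_eq hm hα0 hs hK hα₂ hx
  · rw [hlaw]
    exact (withDensity_ofReal_eq_mulDensity (fun x hx => if_neg (not_lt.2 hx.le))
      fun x hx => if_pos hx).symm
  · rw [cdf_eq_real, measureReal_eq_zero_iff, hlaw]
    refine measure_mono_null (fun y (hy : y ≤ x) => ?_) (ae_pos_mulDensity H)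
    exact not_lt.2 (hy.trans hx)
  · obtain ⟨h1, h2⟩ := outputCDFFormula_eq (L := L) (g := g) (msq := msq) hm hα0 hs hK hα₂ hx
    rw [← h2, cdf_eq_real, measureReal_def, hlaw, mulDensity, withDensity_apply _ measurableSet_Iic,
      Measure.restrict_restrict measurableSet_Iic, Set.inter_comm, Set.Ioi_inter_Iic,
      ← ofReal_integral_eq_lintegral_ofReal h1, ENNReal.toReal_ofReal]
    · exact setIntegral_nonneg measurableSet_Ioc fun t ht =>
        mul_nonneg (inv_nonneg.2 ht.1.le) (hH0 t ht.1)
    · filter_upwards [ae_restrict_mem measurableSet_Ioc] with t ht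
      exact mul_nonneg (inv_nonneg.2 ht.1.le) (hH0 t ht.1)
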